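/- Let $\Bbbk$ be an infinite field, let $m,n,r\ge 0$ be integers, and let $Z=(z_{ij})$ be an $m\times n$ matrix of variables. Let $I_{r+1}(Z)\subseteq\Bbbk[Z]$ be the ideal generated by all $(r+1)$-minors of $Z$. For $\Omega\subseteq[m]\times[n]$ write $Z_\Omega=\{z_{ij} : (i,j)\in\Omega\}$. The set $\Omega$ is called independent in the determinantal matroid $\mathcal M(r,[m]\times[n])$ if $I_{r+1}(Z)\cap\Bbbk[Z_\Omega]=0$, and dependent otherwise. For $\mathcal T\subseteq[m]\times[n]$ let $I_{\mathcal T}\subseteq\Bbbk[Z_{\mathcal T}]$ be the ideal of $\Bbbk[Z_{\mathcal T}]$ generated by those $(r+1)$-minors of $Z$ all of whose entries lie in $Z_{\mathcal T}$. Assume that $r=1$ or $r\ge\min(m,n)-2$, and let $\Omega\subseteq[m]\times[n]$. Then: (a) If $\Omega$ is dependent, then there are $\mathcal I\subseteq[m]$ and $\mathcal J\subseteq[n]$ with $|\mathcal I|>r$, $|\mathcal J|>r$ and $|\Omega\cap(\mathcal I\times\mathcal J)|>r(|\mathcal I|+|\mathcal J|-r)$. (b) $\Omega$ is dependent if and only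 if there is a set $\mathcal T\subseteq[m]\times[n]$ with $\operatorname{height}(I_{\mathcal T})>|\mathcal T\setminus\Omega|$. (c) $\Omega$ is dependent if and only if there are $s\ge 1$ and sets $\mathcal I_\alpha\subseteq[m]$, $\mathcal J_\alpha\subseteq[n]$ with $|\mathcal I_\alpha|,|\mathcal J_\alpha|>r$ for $\alpha=1,\dots,s$, such that for each $1<\alpha\le s$ there are $\mathcal I'_\alpha\subseteq[m]$, $\mathcal J'_\alpha\subseteq[n]$ with $\min(|\mathcal I'_\alpha|,|\mathcal J'_\alpha|)\le r$ and $$(\mathcal I_\alpha\times\mathcal J_\alpha)\cap\bigcup_{\beta<\alpha}(\mathcal I_\beta\times\mathcal J_\beta)\subseteq\mathcal I'_\alpha\times\mathcal J'_\alpha,$$ and such that $$\Bigl|\bigcup_{\alpha=1}^s(\mathcal I_\alpha\times\mathcal J_\alpha)\setminus\Omega\Bigr|<\sum_{\alpha=1}^s(|\mathcal I_\alpha|-r)(|\mathcal J_\alpha|-r).$$ -/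

import Mathlib

namespace DeterminantalMatroid

/-- The set of all `t`-minors of the generic `m × n` matrix `Z = (z_{ij})`, as elements of the
polynomial ring `k[Z]`. -/
def minors (k : Type*) [Field k] (m n t : ℕ) : Set (MvPolynomial (Fin m × Fin n) k) :=
  {p | ∃ (f : Fin t ↪o Fin m) (g : Fin t ↪o Fin n),
    p = ((Matrix.mvPolynomialX (Fin m) (Fin n) k).submatrix f g).det}

/-- The determinantal ideal `I_t(Z)`, generated by all `t`-minors of `Z`. -/
noncomputable def detIdeal (k : Type*) [Field k] (m n t : ℕ) : Ideal (MvPolynomial (Fin m × Fin n) k) :=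
  Ideal.span (minors k m n t)

/-- The elimination ideal `E_Ω = I_{r+1}(Z) ∩ k[Z_Ω]`, an ideal of `k[Z_Ω]`; the inclusion
`k[Z_Ω] ⊆ k[Z]` is the renaming of variables along `Ω ⊆ [m] × [n]`. -/
noncomputable def elimIdeal (k : Type*) [Field k] {m n : ℕ} (r : ℕ)
    (Ω : Finset (Fin m × Fin n)) : Ideal (MvPolynomial {x // x ∈ Ω} k) :=
  (detIdeal k m n (r + 1)).comap
    (MvPolynomial.rename (Subtype.val : {x // x ∈ Ω} → Fin m × Fin n) :
      MvPolynomial {x // x ∈ Ω} k →ₐ[k] MvPolynomial (Fin m × Fin n) k)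

/-- `Ω` is independent in the determinantal matroid `M(r, [m] × [n])` iff `E_Ω = 0`. -/
def IsIndependent (k : Type*) [Field k] {m n : ℕ} (r : ℕ)
    (Ω : Finset (Fin m × Fin n)) : Prop :=
  elimIdeal k r Ω = ⊥

/-- `Ω` is dependent in the determinantal matroid `M(r, [m] × [n])`. -/
def IsDependent (k : Type*) [Field k] {m n : ℕ} (r : ℕ)
    (Ω : Finset (Fin m × Fin n)) : Prop :=
  ¬ IsIndependent k r Ω

/-- The ideal `I_T` of `k[Z_T]` generated by those `(r+1)`-minors of `Z` that lie in `k[Z_T]`,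
i.e. by the `(r+1)`-minors all of whose entries are supported on `T`. -/
noncomputable def supportedIdeal (k : Type*) [Field k] {m n : ℕ} (r : ℕ)
    (T : Finset (Fin m × Fin n)) : Ideal (MvPolynomial {x // x ∈ T} k) :=
  Ideal.span {p : MvPolynomial {x // x ∈ T} k |
    MvPolynomial.rename Subtype.val p ∈ minors k m n (r + 1)}

/-- The height criterion detects `Ω`: there is `T` with `height(I_T) > |T \ Ω|`. -/
def HeightDetects (k : Type*) [Field k] {m n : ℕ} (r : ℕ)
    (Ω : Finset (Fin m × Fin n)) : Prop :=
  ∃ T : Finset (Fin m × Fin n), ((T \ Ω).card : ℕ∞) < (supportedIdeal k r T).height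

/-- The block criterion detects `Ω`: there are blocks `I_α × J_α`, `α = 1, …, s`, with
`|I_α|, |J_α| > r`, such that for `α > 1` the intersection of `I_α × J_α` with the union of the
preceding blocks lies in some `I' × J'` with `min(|I'|, |J'|) ≤ r`, and
`|(⋃_α I_α × J_α) \ Ω| < ∑_α (|I_α| - r)(|J_α| - r)`. The subtractions do not truncate. -/
def BlocksDetect {m n : ℕ} (r : ℕ) (Ω : Finset (Fin m × Fin n)) : Prop :=
  ∃ (s : ℕ) (I : Fin s → Finset (Fin m)) (J : Fin s → Finset (Fin n)),
    (∀ α, r < (I α).card ∧ r < (J α).card) ∧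
    (∀ α : Fin s, 0 < α.val → ∃ (I' : Finset (Fin m)) (J' : Finset (Fin n)),
      min I'.card J'.card ≤ r ∧
      (I α ×ˢ J α) ∩ ((Finset.univ.filter fun β => β < α).biUnion fun β => I β ×ˢ J β)
        ⊆ I' ×ˢ J') ∧
    ((Finset.univ.biUnion fun α => I α ×ˢ J α) \ Ω).card
      < ∑ α, ((I α).card - r) * ((J α).card - r)

end DeterminantalMatroid

/-!
The theorem rests on two independent descriptions of dependence.

*Dense blocks.* A polynomial in `I_{r+1}(Z)` vanishes on every matrix of the form `X Y`, where `X`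
has `r` columns. If the differential of `(X, Y) ↦ X Y` at some point `(X₀, Y₀)`, restricted to the
entries in `Ω`, is surjective, then comparing lowest homogeneous components along the arcs
`(X₀ + ε A) (Y₀ + ε B)` shows that no nonzero polynomial in `k[Z_Ω]` vanishes on all `X Y`; this
is `IsInfinitesimallyIndependent.isIndependent`, valid in every characteristic because no
polynomial is differentiated. For `r = 1` take all entries of `X₀` and `Y₀` equal to one:
surjectivity then means that `Ω` is a forest, which follows from the absence of dense blocks. If
`m ≤ r + 2`, take a Vandermonde matrix for `X₀` and standard basis vectors for the columns of `Y₀`.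
Only columns with more than `r` entries in `Ω` matter, and surjectivity reduces to assigning these
columns to the `r` basis vectors in such a way that at most two share a vector, and two which do
have at most `r` rows in common. The absence of dense blocks gives the counts which make
such an assignment possible. So a dependent set contains more than `r (|I| + |J| - r)` elements of
some block `I × J` (`IsSparse.isIndependent`).

*From blocks back to dependence.* A matrix over a field whose `(r + 1)`-minors vanish factors as
`X Y`, so a polynomial vanishing on the generic product lies in every prime containing the minors
(`aeval_eq_zero_of_generic`). This gives two things.

For a block `I × J`, deform the generic product by independent variables at positions outside a
cross of `r` rows and `r` columns. Removing the deformations one at a time yields a strictly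
increasing chain of prime relation ideals, whose last term lies in every prime containing the
minors of the block. Hence the height of the ideal of minors is at least `(|I| - r) (|J| - r)`
(`le_height_supportedIdeal`), and a dense block satisfies the height criterion. Conversely, an
ideal of `k[Z_T]` meeting `k[Z_{T ∩ Ω}]` in zero has height at most `|T \ Ω|`, as one sees after
inverting the nonzero polynomials in `Z_{T ∩ Ω}` (`HeightDetects.isDependent`).

For the block criterion, independence of `Ω` implies independence in the algebraic matroid of the
entries of the generic product. There a block has nullity at least `(|I| - r) (|J| - r)`, because
its entries are algebraic over those of a cross, and sets of entries inside `r` rows or `r` columns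
are independent. Submodularity of the rank adds these nullities (`rank_biUnion_add_sum_le`), which
contradicts independence of `Ω` when the union of the blocks has too few entries outside `Ω`.
-/

namespace DeterminantalMatroid

open MvPolynomial

/-! ### Matrices of bounded rank -/

/-- A product with inner dimension `r` has vanishing `(r + 1)`-minors, over any commutative ring:
padding both factors by zeros writes the minor as the determinant of a product of square matrices,
one of which has a zero column. -/
theorem det_submatrix_mul_eq_zero {R α β : Type*} [CommRing R] {r : ℕ}
    (X : Matrix α (Fin r) R) (Y : Matrix (Fin r) β R) (f : Fin (r + 1) → α) (g : Fin (r + 1) → β) :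
    ((X * Y).submatrix f g).det = 0 := by
  let X' : Matrix (Fin (r + 1)) (Fin (r + 1)) R :=
    Matrix.of fun i l => Fin.cases 0 (fun l => X (f i) l) l
  let Y' : Matrix (Fin (r + 1)) (Fin (r + 1)) R :=
    Matrix.of fun l j => Fin.cases 0 (fun l => Y l (g j)) l
  have h : (X * Y).submatrix f g = X' * Y' := by
    ext i j
    rw [Matrix.mul_apply, Fin.sum_univ_succ]
    simp [Matrix.mul_apply, X', Y']
  rw [h, Matrix.det_mul, Matrix.det_eq_zero_of_column_eq_zero 0 (fun i => by simp [X']), zero_mul]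

theorem exists_linearIndependent_comp_of_le_finrank {K V ι : Type*} [Field K] [AddCommGroup V]
    [Module K V] [Finite ι] (v : ι → V) {t : ℕ}
    (h : t ≤ Module.finrank K (Submodule.span K (Set.range v))) :
    ∃ g : Fin t → ι, Function.Injective g ∧ LinearIndependent K (v ∘ g) := by
  obtain ⟨κ, a, ha, hsp, hli⟩ := exists_linearIndependent' K v
  have : Finite κ := Finite.of_injective a ha
  have := Fintype.ofFinite κ
  rw [← hsp, finrank_span_eq_card hli] at h
  obtain ⟨e⟩ : Nonempty (Fin t ↪ κ) := Function.Embedding.nonempty_of_card_le (by simpa using h)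
  exact ⟨a ∘ e, ha.comp e.injective, hli.comp e e.injective⟩

/-- An injective family indexed by `Fin t` is an increasing one up to a permutation. -/
theorem exists_orderEmbedding_comp_perm {α : Type*} [LinearOrder α] {t : ℕ} (f : Fin t → α)
    (hf : Function.Injective f) : ∃ (f' : Fin t ↪o α) (σ : Equiv.Perm (Fin t)), f = f' ∘ σ := by
  have hmono : StrictMono (f ∘ Tuple.sort f) :=
    (Tuple.monotone_sort f).strictMono_of_injective (hf.comp (Equiv.injective _))
  refine ⟨OrderEmbedding.ofStrictMono _ hmono, (Tuple.sort f).symm, ?_⟩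
  ext x
  simp

/-- Over a field, a matrix whose `(r + 1)`-minors all vanish factors through `K ^ r`. -/
theorem exists_eq_mul_of_minors_eq_zero {K α β : Type*} [Field K] [Fintype α] [LinearOrder α]
    [Fintype β] [LinearOrder β] {r : ℕ} (M : Matrix α β K)
    (h : ∀ (f : Fin (r + 1) ↪o α) (g : Fin (r + 1) ↪o β), (M.submatrix f g).det = 0) :
    ∃ (X : Matrix α (Fin r) K) (Y : Matrix (Fin r) β K), M = X * Y := by
  classical
  have hrank : Module.finrank K (Submodule.span K (Set.range M.col)) ≤ r := by
    by_contra! hlt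
    obtain ⟨g, hg, hgl⟩ := exists_linearIndependent_comp_of_le_finrank M.col hlt
    let N : Matrix α (Fin (r + 1)) K := M.submatrix id g
    have hN : r + 1 ≤ Module.finrank K (Submodule.span K (Set.range N.row)) := by
      rw [← Matrix.rank_eq_finrank_span_row, ← Matrix.rank_transpose]
      have : LinearIndependent K N.transpose.row := hgl
      rw [this.rank_matrix, Fintype.card_fin]
    obtain ⟨f, hf, hfl⟩ := exists_linearIndependent_comp_of_le_finrank N.row hN
    have hu : IsUnit (M.submatrix f g) := by
      rw [← Matrix.linearIndependent_rows_iff_isUnit]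
      exact hfl
    obtain ⟨f', σ, rfl⟩ := exists_orderEmbedding_comp_perm f hf
    obtain ⟨g', τ, rfl⟩ := exists_orderEmbedding_comp_perm g hg
    have h2 : M.submatrix (f' ∘ σ) (g' ∘ τ) = (M.submatrix f' g').submatrix σ τ := rfl
    rw [h2, Matrix.isUnit_submatrix_equiv, Matrix.isUnit_iff_isUnit_det, h] at hu
    exact not_isUnit_zero hu
  obtain ⟨κ, a, ha, hsp, hli⟩ := exists_linearIndependent' K M.col
  have : Finite κ := Finite.of_injective a ha
  have := Fintype.ofFinite κ
  rw [← hsp, finrank_span_eq_card hli] at hrank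
  obtain ⟨e⟩ : Nonempty (κ ↪ Fin r) := Function.Embedding.nonempty_of_card_le (by simpa using hrank)
  have hmem : ∀ j, ∃ c : κ → K, ∑ l, c l • M.col (a l) = M.col j := fun j => by
    have : M.col j ∈ Submodule.span K (Set.range (M.col ∘ a)) :=
      hsp ▸ Submodule.subset_span ⟨j, rfl⟩
    exact (Submodule.mem_span_range_iff_exists_fun K).1 this
  choose c hc using hmem
  refine ⟨Matrix.of fun i p => ∑ l, if e l = p then M i (a l) else 0,
    Matrix.of fun p j => ∑ l, if e l = p then c j l else 0, ?_⟩
  ext i j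
  have h1 := congrFun (hc j) i
  simp only [Finset.sum_apply, Pi.smul_apply, smul_eq_mul, Matrix.col_apply] at h1
  rw [Matrix.mul_apply, ← h1, ← Finset.sum_subset (Finset.subset_univ (Finset.univ.map e))]
  · rw [Finset.sum_map]
    refine Finset.sum_congr rfl fun l _ => ?_
    simp [EmbeddingLike.apply_eq_iff_eq, mul_comm]
  · intro p _ hp
    have hne : ∀ l, e l ≠ p := fun l hl => hp (by simp [← hl])
    simp [hne]

/-! ### Elementary properties of the elimination ideal -/

section

variable {k : Type*} [Field k] {m n : ℕ}

theorem aeval_det_submatrix {A ι : Type*} [CommRing A] [Algebra k A] [Fintype ι] [DecidableEq ι]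
    (M : Matrix (Fin m) (Fin n) A) (f : ι → Fin m) (g : ι → Fin n) :
    aeval (fun p : Fin m × Fin n => M p.1 p.2)
      ((Matrix.mvPolynomialX (Fin m) (Fin n) k).submatrix f g).det = (M.submatrix f g).det := by
  rw [AlgHom.map_det]
  congr 1
  ext i j
  simp

/-- A matrix over a `k`-algebra with vanishing `(r + 1)`-minors is a zero of `I_{r+1}(Z)`. -/
theorem aeval_eq_zero_of_mem_detIdeal {A : Type*} [CommRing A] [Algebra k A] {t : ℕ}
    (M : Matrix (Fin m) (Fin n) A)
    (hM : ∀ (f : Fin t ↪o Fin m) (g : Fin t ↪o Fin n), (M.submatrix f g).det = 0)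
    {F : MvPolynomial (Fin m × Fin n) k} (hF : F ∈ detIdeal k m n t) :
    aeval (fun p : Fin m × Fin n => M p.1 p.2) F = 0 := by
  have : detIdeal k m n t ≤
      RingHom.ker (aeval (R := k) fun p : Fin m × Fin n => M p.1 p.2) := by
    rw [detIdeal, Ideal.span_le]
    rintro _ ⟨f, g, rfl⟩
    exact (aeval_det_submatrix M f g).trans (hM f g)
  exact this hF

theorem isIndependent_iff {r : ℕ} {Ω : Finset (Fin m × Fin n)} :
    IsIndependent k r Ω ↔ ∀ F : MvPolynomial {x // x ∈ Ω} k,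
      rename Subtype.val F ∈ detIdeal k m n (r + 1) → F = 0 := by
  rw [IsIndependent, elimIdeal, Submodule.eq_bot_iff]
  rfl

theorem IsIndependent.subset {r : ℕ} {Ω Ω' : Finset (Fin m × Fin n)} (h : IsIndependent k r Ω)
    (hs : Ω' ⊆ Ω) : IsIndependent k r Ω' := by
  rw [isIndependent_iff] at h ⊢
  intro F hF
  have hinj : Function.Injective fun x : {x // x ∈ Ω'} => (⟨x.1, hs x.2⟩ : {x // x ∈ Ω}) :=
    fun x y hxy => Subtype.ext (by simpa using hxy)
  refine (map_eq_zero_iff _ (rename_injective _ hinj)).1 (h _ ?_)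
  rwa [rename_rename]

end

/-! ### The infinitesimal criterion for independence -/

theorem aeval_mul_of_isHomogeneous {k σ A : Type*} [CommSemiring k] [CommSemiring A] [Algebra k A]
    {H : MvPolynomial σ k} {e : ℕ} (hH : H.IsHomogeneous e) (t : A) (w : σ → A) :
    aeval (fun i => t * w i) H = t ^ e * aeval w H := by
  rw [aeval_def, aeval_def, eval₂_eq, eval₂_eq, Finset.mul_sum]
  refine Finset.sum_congr rfl fun d hd => ?_
  have hdeg : d.degree = e := by
    rw [← hH (mem_support_iff.1 hd), Finsupp.degree_eq_weight_one]
    rfl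
  rw [← hdeg, Finsupp.degree_apply]
  simp only [mul_pow, Finset.prod_mul_distrib, Finset.prod_pow_eq_pow_sum]
  ring

/-- The lowest-order form: if `G ≠ 0`, then the lowest homogeneous component `H` of `G` at the
point `z` vanishes at every `a` for which `G` vanishes along an arc `z + ε a + ε² b`. -/
theorem exists_ne_zero_eval_eq_zero_of_arc {k σ : Type*} [Field k] (G : MvPolynomial σ k)
    (hG : G ≠ 0) (z : σ → k) :
    ∃ H : MvPolynomial σ k, H ≠ 0 ∧ ∀ a b : σ → k,
      aeval (fun i => Polynomial.C (z i) + Polynomial.X *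
        (Polynomial.C (a i) + Polynomial.X * Polynomial.C (b i))) G = 0 → eval a H = 0 := by
  classical
  set G' : MvPolynomial σ k := aeval (fun i => X i + C (z i)) G with hG'
  have hG0 : G' ≠ 0 := by
    intro h0
    apply hG
    have : aeval (fun i => X i - C (z i) : σ → MvPolynomial σ k) G' = G := by
      rw [hG', ← AlgHom.comp_apply, comp_aeval]
      simp
    rw [← this, h0, map_zero]
  have hex : ∃ d, homogeneousComponent d G' ≠ 0 := by
    by_contra! hall
    apply hG0
    rw [← sum_homogeneousComponent G']
    exact Finset.sum_eq_zero fun i _ => hall i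
  set d := Nat.find hex
  refine ⟨homogeneousComponent d G', Nat.find_spec hex, fun a b hab => ?_⟩
  set w : σ → Polynomial k := fun i => Polynomial.C (a i) + Polynomial.X * Polynomial.C (b i)
  have hscale : ∀ e, aeval (fun i => Polynomial.X * w i) (homogeneousComponent e G') =
      Polynomial.X ^ e * aeval w (homogeneousComponent e G') := by
    intro e
    exact aeval_mul_of_isHomogeneous (homogeneousComponent_isHomogeneous e G') _ w
  have h1 : aeval (fun i => Polynomial.X * w i) G' = 0 := by
    rw [hG', ← AlgHom.comp_apply, comp_aeval, ← hab]
    congr 2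
    ext1 i
    simp [add_comm, w]
  have hd : d ≤ G'.totalDegree := by
    by_contra! hlt
    exact Nat.find_spec hex (homogeneousComponent_eq_zero _ _ hlt)
  rw [← sum_homogeneousComponent G', map_sum, ← Finset.sum_range_add_sum_Ico _ (Nat.le_succ_of_le hd),
    Finset.sum_eq_zero, zero_add, Finset.sum_eq_sum_Ico_succ_bot (Nat.lt_succ_of_le hd)] at h1
  · have h2 : Polynomial.X ^ d * (aeval w (homogeneousComponent d G') +
      Polynomial.X * ∑ e ∈ Finset.Ico (d + 1) (G'.totalDegree + 1), Polynomial.X ^ (e - (d + 1)) *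
        aeval w (homogeneousComponent e G')) = 0 := by
      rw [← h1, hscale, mul_add, Finset.mul_sum, Finset.mul_sum]
      congr 1
      refine Finset.sum_congr rfl fun e he => ?_
      rw [hscale, ← mul_assoc, ← mul_assoc, ← pow_succ, ← pow_add]
      congr 2
      have := (Finset.mem_Ico.1 he).1
      omega
    have h3 := (mul_eq_zero.1 h2).resolve_left (pow_ne_zero _ Polynomial.X_ne_zero)
    have h4 := congrArg (Polynomial.aeval (0 : k)) h3
    rw [map_add, map_mul, Polynomial.aeval_X, zero_mul, add_zero, map_zero, comp_aeval_apply] at h4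
    rw [← h4, ← coe_aeval_eq_eval]
    simp [w]
  · intro e he
    have := Nat.find_min hex (Finset.mem_range.1 he)
    rw [not_not.1 this, map_zero]

/-- `Ω` is infinitesimally independent if, at some pair `(X₀, Y₀)` of an `m × r` and an `r × n`
matrix, the differential of `(X, Y) ↦ X Y`, followed by restriction to the entries in `Ω`,
is surjective. -/
def IsInfinitesimallyIndependent (k : Type*) [Field k] {m n : ℕ} (r : ℕ)
    (Ω : Finset (Fin m × Fin n)) : Prop :=
  ∃ (X₀ : Matrix (Fin m) (Fin r) k) (Y₀ : Matrix (Fin r) (Fin n) k),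
    ∀ v : Fin m × Fin n → k, ∃ (A : Matrix (Fin m) (Fin r) k) (B : Matrix (Fin r) (Fin n) k),
      ∀ x ∈ Ω, (A * Y₀ + X₀ * B) x.1 x.2 = v x

/-- Over an infinite field of any characteristic, infinitesimal independence implies independence:
a polynomial relation `F` would vanish along the arcs `(X₀ + ε A) (Y₀ + ε B)`, whose velocities
are arbitrary on `Ω`, so its lowest homogeneous component at `X₀ Y₀` would vanish identically. -/
theorem IsInfinitesimallyIndependent.isIndependent {k : Type*} [Field k] [Infinite k] {m n r : ℕ}
    {Ω : Finset (Fin m × Fin n)} (h : IsInfinitesimallyIndependent k r Ω) :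
    IsIndependent k r Ω := by
  obtain ⟨X₀, Y₀, hsurj⟩ := h
  rw [isIndependent_iff]
  intro F hF
  by_contra hF0
  obtain ⟨H, hH0, hH⟩ := exists_ne_zero_eval_eq_zero_of_arc F hF0
    (fun x => (X₀ * Y₀) x.1.1 x.1.2)
  refine hH0 (MvPolynomial.funext fun a => ?_)
  rw [map_zero]
  obtain ⟨A, B, hAB⟩ := hsurj (fun x => if hx : x ∈ Ω then a ⟨x, hx⟩ else 0)
  refine hH a (fun x => (A * B) x.1.1 x.1.2) ?_
  have hz := aeval_eq_zero_of_mem_detIdeal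
    ((X₀.map Polynomial.C + Polynomial.X (R := k) • A.map Polynomial.C) *
      (Y₀.map Polynomial.C + Polynomial.X (R := k) • B.map Polynomial.C))
    (fun f g => det_submatrix_mul_eq_zero _ _ f g) hF
  rw [aeval_rename] at hz
  rw [← hz]
  congr 2
  ext1 x
  have hx := hAB x.1 x.2
  rw [dif_pos x.2] at hx
  simp only [Function.comp_apply, ← hx, Matrix.add_apply, Matrix.mul_apply, Matrix.smul_apply,
    Matrix.map_apply, smul_eq_mul, map_add, map_sum, map_mul, mul_add, add_mul,
    Finset.mul_sum, ← Finset.sum_add_distrib]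
  exact Finset.sum_congr rfl fun l _ => by ring

/-! ### Sparse sets of entries are infinitesimally independent -/

/-- `Ω` is sparse if no block `I × J` with `|I|, |J| > r` contains more than `r (|I| + |J| - r)`
elements of `Ω`. The subtraction does not truncate. -/
def IsSparse {m n : ℕ} (r : ℕ) (Ω : Finset (Fin m × Fin n)) : Prop :=
  ∀ (I : Finset (Fin m)) (J : Finset (Fin n)), r < I.card → r < J.card →
    (Ω ∩ (I ×ˢ J)).card ≤ r * (I.card + J.card - r)

theorem IsSparse.image_swap {m n r : ℕ} {Ω : Finset (Fin m × Fin n)} (h : IsSparse r Ω) :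
    IsSparse r (Ω.image Prod.swap) := by
  intro I J hI hJ
  have : Ω.image Prod.swap ∩ (I ×ˢ J) = (Ω ∩ (J ×ˢ I)).image Prod.swap := by
    ext ⟨i, j⟩
    simp [and_comm]
  rw [this, Finset.card_image_of_injective _ Prod.swap_injective, add_comm]
  exact h J I hJ hI

theorem IsInfinitesimallyIndependent.of_image_swap {k : Type*} [Field k] {m n r : ℕ}
    {Ω : Finset (Fin m × Fin n)}
    (h : IsInfinitesimallyIndependent k r (Ω.image Prod.swap)) :
    IsInfinitesimallyIndependent k r Ω := by
  obtain ⟨X₀, Y₀, hXY⟩ := h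
  refine ⟨Y₀.transpose, X₀.transpose, fun v => ?_⟩
  obtain ⟨A, B, hAB⟩ := hXY (v ∘ Prod.swap)
  refine ⟨B.transpose, A.transpose, fun x hx => ?_⟩
  have := hAB x.swap (Finset.mem_image_of_mem _ hx)
  rw [← Matrix.transpose_mul, ← Matrix.transpose_mul, ← Matrix.transpose_add, add_comm]
  simpa using this

/-! ### Rank one: forests -/

/-- A nonempty sparse set for `r = 1`, viewed as a bipartite graph, has a leaf. -/
theorem IsSparse.exists_leaf {m n : ℕ} {Ω : Finset (Fin m × Fin n)} (h : IsSparse 1 Ω)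
    (hne : Ω.Nonempty) :
    ∃ x ∈ Ω, (∀ y ∈ Ω, y.1 = x.1 → y = x) ∨ (∀ y ∈ Ω, y.2 = x.2 → y = x) := by
  by_contra! hno
  have h1 : 2 * (Ω.image Prod.fst).card ≤ Ω.card := by
    refine Finset.mul_card_image_le_card_of_maps_to (fun x hx => Finset.mem_image_of_mem _ hx) 2 ?_
    intro i hi
    obtain ⟨x, hx, rfl⟩ := Finset.mem_image.1 hi
    obtain ⟨y, hy, hyx, hne⟩ := (hno x hx).1
    exact Nat.succ_le_of_lt (Finset.one_lt_card.2
      ⟨y, by simp [hy, hyx], x, by simp [hx], hne⟩)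
  have h2 : 2 * (Ω.image Prod.snd).card ≤ Ω.card := by
    refine Finset.mul_card_image_le_card_of_maps_to (fun x hx => Finset.mem_image_of_mem _ hx) 2 ?_
    intro i hi
    obtain ⟨x, hx, rfl⟩ := Finset.mem_image.1 hi
    obtain ⟨y, hy, hyx, hne⟩ := (hno x hx).2
    exact Nat.succ_le_of_lt (Finset.one_lt_card.2
      ⟨y, by simp [hy, hyx], x, by simp [hx], hne⟩)
  obtain ⟨x, hx⟩ := hne
  have h3 : 1 < (Ω.image Prod.fst).card := by
    obtain ⟨y, hy, hyx, hne⟩ := (hno x hx).2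
    exact Finset.one_lt_card.2 ⟨y.1, Finset.mem_image_of_mem _ hy, x.1,
      Finset.mem_image_of_mem _ hx, fun h => hne (Prod.ext h hyx)⟩
  have h4 : 1 < (Ω.image Prod.snd).card := by
    obtain ⟨y, hy, hyx, hne⟩ := (hno x hx).1
    exact Finset.one_lt_card.2 ⟨y.2, Finset.mem_image_of_mem _ hy, x.2,
      Finset.mem_image_of_mem _ hx, fun h => hne (Prod.ext hyx h)⟩
  have h5 := h _ _ h3 h4
  rw [Finset.inter_eq_left.2 Finset.subset_product] at h5
  omega

theorem IsSparse.subset {m n r : ℕ} {Ω Ω' : Finset (Fin m × Fin n)} (h : IsSparse r Ω)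
    (hs : Ω' ⊆ Ω) : IsSparse r Ω' := fun I J hI hJ =>
  (Finset.card_le_card (Finset.inter_subset_inter_right hs)).trans (h I J hI hJ)

theorem IsSparse.exists_add_eq {k : Type*} [Field k] {m n : ℕ} (v : Fin m × Fin n → k)
    (Ω : Finset (Fin m × Fin n)) (h : IsSparse 1 Ω) :
    ∃ (a : Fin m → k) (b : Fin n → k), ∀ x ∈ Ω, a x.1 + b x.2 = v x := by
  induction Ω using Finset.strongInduction with
  | H Ω ih =>
    rcases Ω.eq_empty_or_nonempty with rfl | hne
    · exact ⟨0, 0, by simp⟩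
    obtain ⟨x, hx, hleaf⟩ := h.exists_leaf hne
    obtain ⟨a, b, hab⟩ := ih (Ω.erase x) (Finset.erase_ssubset hx) (h.subset (Finset.erase_subset _ _))
    rcases hleaf with hleaf | hleaf
    · refine ⟨Function.update a x.1 (v x - b x.2), b, fun y hy => ?_⟩
      by_cases hyx : y = x
      · subst hyx
        simp
      · rw [Function.update_of_ne fun h => hyx (hleaf y hy h)]
        exact hab y (Finset.mem_erase.2 ⟨hyx, hy⟩)
    · refine ⟨a, Function.update b x.2 (v x - a x.1), fun y hy => ?_⟩
      by_cases hyx : y = x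
      · subst hyx
        simp
      · rw [Function.update_of_ne fun h => hyx (hleaf y hy h)]
        exact hab y (Finset.mem_erase.2 ⟨hyx, hy⟩)

theorem IsSparse.isInfinitesimallyIndependent_one {k : Type*} [Field k] {m n : ℕ}
    {Ω : Finset (Fin m × Fin n)} (h : IsSparse 1 Ω) : IsInfinitesimallyIndependent k 1 Ω := by
  refine ⟨Matrix.of fun _ _ => 1, Matrix.of fun _ _ => 1, fun v => ?_⟩
  obtain ⟨a, b, hab⟩ := h.exists_add_eq v
  exact ⟨Matrix.of fun i _ => a i, Matrix.of fun _ j => b j,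
    fun x hx => by simpa [Matrix.mul_apply] using hab x hx⟩

/-! ### Corank at most two -/

/-- The rows of the entries of `Ω` in column `j`. -/
def colSupport {m n : ℕ} (Ω : Finset (Fin m × Fin n)) (j : Fin n) : Finset (Fin m) :=
  Finset.univ.filter fun i => (i, j) ∈ Ω

theorem mem_colSupport {m n : ℕ} {Ω : Finset (Fin m × Fin n)} {i : Fin m} {j : Fin n} :
    i ∈ colSupport Ω j ↔ (i, j) ∈ Ω := by
  simp [colSupport]

/-- A Vandermonde matrix with distinct nodes: any `r` of its rows are linearly independent. -/
theorem exists_matrix_interpolating (k : Type*) [Field k] [Infinite k] (m r : ℕ) :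
    ∃ X : Matrix (Fin m) (Fin r) k, ∀ (S : Finset (Fin m)), S.card ≤ r → ∀ v : Fin m → k,
      ∃ w : Fin r → k, ∀ i ∈ S, X.mulVec w i = v i := by
  let t : Fin m ↪ k := Fin.valEmbedding.trans (Infinite.natEmbedding k)
  refine ⟨Matrix.of fun i l => t i ^ (l : ℕ), fun S hS v => ?_⟩
  let P := Lagrange.interpolate S t v
  have hinj : Set.InjOn t S := t.injective.injOn
  have hdeg : P.degree < r :=
    (Lagrange.degree_interpolate_lt v hinj).trans_le (by exact_mod_cast hS)
  refine ⟨fun l => P.coeff l, fun i hi => ?_⟩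
  rw [← Lagrange.eval_interpolate_at_node v hinj hi]
  change _ = P.eval (t i)
  rw [Polynomial.eval_eq_sum_range' (n := r), Finset.sum_range]
  · simp [Matrix.mulVec, dotProduct, mul_comm]
  · rcases eq_or_ne P 0 with h0 | h0
    · have := Finset.card_pos.2 ⟨i, hi⟩
      rw [h0, Polynomial.natDegree_zero]
      omega
    · exact (Polynomial.natDegree_lt_iff_degree_lt h0).2 hdeg

/-- Columns with at most `r` entries in `Ω` impose no condition. If the other columns can be
assigned to the `r` directions so that at most two columns share a direction, and two columns
sharing one have at most `r` rows in common, then `Ω` is infinitesimally independent. -/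
theorem isInfinitesimallyIndependent_of_assignment {k : Type*} [Field k] [Infinite k] {m n r : ℕ}
    {Ω : Finset (Fin m × Fin n)} (p : {j // r < (colSupport Ω j).card} → Fin r)
    (hp3 : ∀ a b c, p a = p b → p b = p c → a = b ∨ b = c ∨ a = c)
    (hp2 : ∀ a b, a ≠ b → p a = p b → (colSupport Ω a.1 ∩ colSupport Ω b.1).card ≤ r) :
    IsInfinitesimallyIndependent k r Ω := by
  obtain ⟨X₀, hX₀⟩ := exists_matrix_interpolating k m r
  refine ⟨X₀, Matrix.of fun l j => if h : r < (colSupport Ω j).card then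
    (if p ⟨j, h⟩ = l then 1 else 0) else 0, fun v => ?_⟩
  -- Column `j` of `A Y₀` is the column of `A` given by the direction of `j`; that column, `d`, has
  -- to agree with the prescribed values in each column assigned to it, up to the image of `X₀`.
  have hdir : ∀ l, ∃ d : Fin m → k, ∀ j, p j = l → ∃ w : Fin r → k,
      ∀ i ∈ colSupport Ω j.1, d i + X₀.mulVec w i = v (i, j.1) := by
    intro l
    by_cases h1 : ∃ a, p a = l
    swap
    · exact ⟨0, fun j hj => (h1 ⟨j, hj⟩).elim⟩
    obtain ⟨a, rfl⟩ := h1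
    by_cases h2 : ∃ b, a ≠ b ∧ p a = p b
    swap
    · push Not at h2
      refine ⟨fun i => v (i, a.1), fun j hj => ⟨0, fun i _ => ?_⟩⟩
      have : a = j := by
        by_contra hne
        exact h2 j hne hj.symm
      simp [this]
    obtain ⟨b, hab, hpab⟩ := h2
    obtain ⟨w, hw⟩ := hX₀ _ (hp2 a b hab hpab) fun i => v (i, b.1) - v (i, a.1)
    -- `d` solves column `a` exactly; on the common rows `X₀ w` accounts for the difference of the
    -- two columns, and on the other rows of column `b` the value of `d` is still free.
    refine ⟨fun i => if i ∈ colSupport Ω a.1 then v (i, a.1) else v (i, b.1) - X₀.mulVec w i,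
      fun j hj => ?_⟩
    have hj' : j = a ∨ j = b := by
      rcases hp3 j a b hj hpab with h | h | h
      · exact Or.inl h
      · exact (hab h).elim
      · exact Or.inr h
    rcases hj' with rfl | rfl
    · refine ⟨0, fun i hi => ?_⟩
      simp [hi]
    · refine ⟨w, fun i hi => ?_⟩
      by_cases hia : i ∈ colSupport Ω a.1
      · simp [hia, hw i (Finset.mem_inter.2 ⟨hia, hi⟩)]
      · simp [hia]
  choose d hd using hdir
  have hcol : ∀ j, ∃ w : Fin r → k, ∀ i ∈ colSupport Ω j,
      (if h : r < (colSupport Ω j).card then d (p ⟨j, h⟩) i else 0) + X₀.mulVec w i = v (i, j) := by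
    intro j
    by_cases h : r < (colSupport Ω j).card
    · obtain ⟨w, hw⟩ := hd _ ⟨j, h⟩ rfl
      exact ⟨w, fun i hi => by simpa [h] using hw i hi⟩
    · obtain ⟨w, hw⟩ := hX₀ _ (not_lt.1 h) fun i => v (i, j)
      exact ⟨w, fun i hi => by simpa [h] using hw i hi⟩
  choose w hw using hcol
  refine ⟨Matrix.of fun i l => d l i, Matrix.of fun l j => w j l, ?_⟩
  rintro ⟨i, j⟩ hx
  rw [← hw j i (mem_colSupport.2 hx), Matrix.add_apply]
  congr 1
  by_cases h : r < (colSupport Ω j).card <;> simp [Matrix.mul_apply, h]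

/-- Elements sorted into classes of size at most `q`, at most `2 q` in total, can be distributed
to `q` places, at most two to a place and no two of a class to the same place: list them class by
class and reduce the position modulo `q`. -/
theorem exists_distribution {A C : Type*} [Fintype A] [Fintype C] [DecidableEq C]
    (cls : A → C) (q : ℕ) (hfib : ∀ c, (Finset.univ.filter fun a => cls a = c).card ≤ q)
    (hcard : Fintype.card A ≤ 2 * q) :
    ∃ p : A → Fin q, (∀ a b c, p a = p b → p b = p c → a = b ∨ b = c ∨ a = c) ∧
      ∀ a b, a ≠ b → p a = p b → cls a ≠ cls b := by
  let e := Fintype.equivFin A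
  let f : Fin (Fintype.card A) → Fin (Fintype.card C) := fun x => Fintype.equivFin C (cls (e.symm x))
  have hmono : Monotone (f ∘ Tuple.sort f) := Tuple.monotone_sort f
  let e' : A ≃ Fin (Fintype.card A) := e.trans (Tuple.sort f).symm
  have hf : ∀ x, f (Tuple.sort f x) = Fintype.equivFin C (cls (e'.symm x)) := fun x => rfl
  have hq : ∀ a : A, 0 < q := fun a => by
    have := (e' a).2
    omega
  -- Two elements at the same place have positions differing by at least `q`.
  have key : ∀ a b, (e' a : ℕ) < e' b → (e' a : ℕ) % q = e' b % q → (e' a : ℕ) + q ≤ e' b := by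
    intro a b hlt hmod
    have := (Nat.modEq_iff_dvd' hlt.le).1 hmod
    have := Nat.le_of_dvd (by omega) this
    omega
  have hlt2 : ∀ a, (e' a : ℕ) < 2 * q := fun a => (e' a).2.trans_le hcard
  refine ⟨fun a => ⟨e' a % q, Nat.mod_lt _ (hq a)⟩, ?_, ?_⟩
  · intro a b c hab hbc
    simp only [Fin.mk.injEq] at hab hbc
    by_contra! hne
    have h1 : (e' a : ℕ) ≠ e' b := fun h => hne.1 (e'.injective (Fin.ext h))
    have h2 : (e' b : ℕ) ≠ e' c := fun h => hne.2.1 (e'.injective (Fin.ext h))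
    have h3 : (e' a : ℕ) ≠ e' c := fun h => hne.2.2 (e'.injective (Fin.ext h))
    have := hlt2 a
    have := hlt2 b
    have := hlt2 c
    have := key a b
    have := key b a
    have := key b c
    have := key c b
    have := key a c
    have := key c a
    omega
  · have hwlog : ∀ a b, (e' a : ℕ) < e' b → (e' a : ℕ) % q = e' b % q → cls a ≠ cls b := by
      intro a b hlt hmod hcls
      have hle := key a b hlt hmod
      -- The whole interval from `a` to `b` would lie in one class, which has at most `q` elements.
      have hsub : (Finset.Icc (e' a) (e' b)).map e'.symm.toEmbedding ⊆
          Finset.univ.filter fun x => cls x = cls a := by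
        intro x hx
        rw [Finset.mem_map] at hx
        obtain ⟨y, hy, rfl⟩ := hx
        rw [Finset.mem_Icc] at hy
        have h1 := hmono hy.1
        have h2 := hmono hy.2
        simp only [Function.comp_apply, hf, Equiv.symm_apply_apply] at h1 h2
        rw [← hcls] at h2
        simpa using le_antisymm h2 h1
      have := (Finset.card_le_card hsub).trans (hfib _)
      rw [Finset.card_map, Fin.card_Icc] at this
      omega
    intro a b hne hab
    simp only [Fin.mk.injEq] at hab
    rcases lt_trichotomy (e' a : ℕ) (e' b) with h | h | h
    · exact hwlog a b h hab
    · exact (hne (e'.injective (Fin.ext h))).elim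
    · exact (hwlog b a h hab.symm).symm

/-- The variant of `exists_distribution` in which some elements require a place of their own. -/
theorem exists_distribution_of_full {A C : Type*} [Fintype A] [Fintype C] [DecidableEq C]
    (full : A → Prop) [DecidablePred full] (cls : A → C) (r : ℕ)
    (hfib : ∀ c, (Finset.univ.filter fun a => full a ∨ cls a = c).card ≤ r)
    (hcard : Fintype.card {a // full a} + Fintype.card A ≤ 2 * r) :
    ∃ p : A → Fin r, (∀ a b c, p a = p b → p b = p c → a = b ∨ b = c ∨ a = c) ∧
      ∀ a b, a ≠ b → p a = p b → ¬ full a ∧ ¬ full b ∧ cls a ≠ cls b := by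
  have hsum : Fintype.card {a // full a} + Fintype.card {a // ¬ full a} = Fintype.card A := by
    rw [Fintype.card_subtype_compl]
    have := Fintype.card_subtype_le full
    omega
  classical
  set c := Fintype.card {a // full a} with hc
  obtain ⟨p', hp3, hp2⟩ := exists_distribution (fun a : {a // ¬ full a} => cls a.1) (r - c) (by
      intro x
      have h1 := hfib x
      have h2 : (Finset.univ.filter fun a : {a // ¬ full a} => cls a.1 = x).card ≤
          (Finset.univ.filter fun a => ¬ full a ∧ cls a = x).card :=
        Finset.card_le_card_of_injOn Subtype.val
          (fun a ha => by simpa using ⟨a.2, (Finset.mem_filter.1 ha).2⟩) Subtype.val_injective.injOn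
      have h3 : c = (Finset.univ.filter full).card := Fintype.card_subtype full
      have h4 : Disjoint (Finset.univ.filter full)
          (Finset.univ.filter fun a => ¬ full a ∧ cls a = x) :=
        Finset.disjoint_filter.2 fun a _ ha hb => hb.1 ha
      have h5 := Finset.card_union_of_disjoint h4
      rw [← Finset.filter_or] at h5
      have h6 : (Finset.univ.filter fun a => full a ∨ ¬ full a ∧ cls a = x) =
          Finset.univ.filter fun a => full a ∨ cls a = x :=
        Finset.filter_congr fun a _ => by tauto
      rw [h6] at h5
      omega) (by omega)
  let e := Fintype.equivFin {a // full a}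
  have hv : ∀ a, (if h : full a then r - c + e ⟨a, h⟩ else p' ⟨a, h⟩ : ℕ) < r := by
    intro a
    split_ifs with h
    · have := (e ⟨a, h⟩).2
      omega
    · have := (p' ⟨a, h⟩).2
      omega
  have hfull : ∀ a b, full a → (if h : full a then r - c + e ⟨a, h⟩ else p' ⟨a, h⟩ : ℕ) =
      (if h : full b then r - c + e ⟨b, h⟩ else p' ⟨b, h⟩ : ℕ) → a = b := by
    intro a b ha hab
    rw [dif_pos ha] at hab
    split_ifs at hab with hb
    · have : e ⟨a, ha⟩ = e ⟨b, hb⟩ := Fin.ext (by omega)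
      exact congrArg Subtype.val (e.injective this)
    · have := (p' ⟨b, hb⟩).2
      omega
  refine ⟨fun a => ⟨_, hv a⟩, ?_, ?_⟩
  · intro x y z hxy hyz
    simp only [Fin.mk.injEq] at hxy hyz
    by_cases hx : full x
    · exact Or.inl (hfull x y hx hxy)
    by_cases hy : full y
    · exact Or.inr (Or.inl (hfull y z hy hyz))
    by_cases hz : full z
    · exact Or.inr (Or.inl (hfull z y hz hyz.symm).symm)
    rw [dif_neg hx, dif_neg hy] at hxy
    rw [dif_neg hy, dif_neg hz] at hyz
    simpa using hp3 ⟨x, hx⟩ ⟨y, hy⟩ ⟨z, hz⟩ (Fin.ext hxy) (Fin.ext hyz)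
  · intro a b hne hab
    simp only [Fin.mk.injEq] at hab
    have ha : ¬ full a := fun ha => hne (hfull a b ha hab)
    have hb : ¬ full b := fun hb => hne (hfull b a hb hab.symm).symm
    rw [dif_neg ha, dif_neg hb] at hab
    exact ⟨ha, hb, hp2 ⟨a, ha⟩ ⟨b, hb⟩ (fun h => hne (congrArg Subtype.val h)) (Fin.ext hab)⟩

theorem card_inter_univ_product {m n : ℕ} (Ω : Finset (Fin m × Fin n)) (J : Finset (Fin n)) :
    (Ω ∩ (Finset.univ ×ˢ J)).card = ∑ j ∈ J, (colSupport Ω j).card := by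
  rw [Finset.card_eq_sum_card_fiberwise (f := Prod.snd) (t := J)
    fun x hx => (Finset.mem_product.1 (Finset.mem_inter.1 hx).2).2]
  refine Finset.sum_congr rfl fun j hj => ?_
  rw [← Finset.card_map (Function.Embedding.sectL (Fin m) j)]
  congr 1
  ext ⟨i, j'⟩
  simp only [Finset.mem_filter, Finset.mem_inter, Finset.mem_product, Finset.mem_univ, true_and,
    Finset.mem_map, mem_colSupport, Function.Embedding.sectL_apply, Prod.mk.injEq]
  constructor
  · rintro ⟨⟨h1, -⟩, rfl⟩
    exact ⟨i, h1, rfl, rfl⟩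
  · rintro ⟨i', h1, rfl, rfl⟩
    exact ⟨⟨h1, hj⟩, rfl⟩

/-- At most `r` columns of a sparse set contain a given `(r + 1)`-set of rows. -/
theorem IsSparse.card_filter_subset_colSupport_le {m n r : ℕ} {Ω : Finset (Fin m × Fin n)}
    (h : IsSparse r Ω) {S : Finset (Fin m)} (hS : S.card = r + 1) :
    (Finset.univ.filter fun j => S ⊆ colSupport Ω j).card ≤ r := by
  by_contra! hlt
  set J := Finset.univ.filter fun j => S ⊆ colSupport Ω j
  have h1 := h S J (by omega) hlt
  have h2 : Ω ∩ (S ×ˢ J) = S ×ˢ J := by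
    refine Finset.inter_eq_right.2 fun x hx => ?_
    rw [Finset.mem_product] at hx
    exact mem_colSupport.1 ((Finset.mem_filter.1 hx.2).2 hx.1)
  rw [h2, Finset.card_product, hS, show r + 1 + J.card - r = J.card + 1 by omega] at h1
  nlinarith

theorem IsSparse.isInfinitesimallyIndependent_of_le {k : Type*} [Field k] [Infinite k] {m n r : ℕ}
    {Ω : Finset (Fin m × Fin n)} (h : IsSparse r Ω) (hm : m ≤ r + 2) :
    IsInfinitesimallyIndependent k r Ω := by
  classical
  have hle : ∀ j, (colSupport Ω j).card ≤ m := fun j => by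
    simpa using Finset.card_le_univ (colSupport Ω j)
  set J := Finset.univ.filter fun j => r < (colSupport Ω j).card with hJ
  set F := Finset.univ.filter fun j => (colSupport Ω j).card = r + 2 with hF
  have hFJ : F ⊆ J := fun j hj => by
    simp only [hF, hJ, Finset.mem_filter, Finset.mem_univ, true_and] at hj ⊢
    omega
  -- With `I` all rows and `J` the heavy columns, sparsity bounds the number of heavy columns, the
  -- full ones counted twice. The condition `r < |J|` fails only when the bound is trivial.
  have hcardle : F.card + J.card ≤ 2 * r := by
    rcases le_or_gt J.card r with hJr | hJr
    · have := Finset.card_le_card hFJ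
      omega
    · obtain ⟨j₀, hj₀⟩ : J.Nonempty := Finset.card_pos.1 (by omega)
      have hj₀' := (Finset.mem_filter.1 hj₀).2
      have hrm : r < m := hj₀'.trans_le (hle j₀)
      have h1 := h Finset.univ J (by simpa using hrm) hJr
      rw [card_inter_univ_product, Finset.card_univ, Fintype.card_fin] at h1
      have h2 : ∑ j ∈ J, (r + 1 + if j ∈ F then 1 else 0) ≤ ∑ j ∈ J, (colSupport Ω j).card := by
        refine Finset.sum_le_sum fun j hj => ?_
        have := (Finset.mem_filter.1 hj).2
        split_ifs with hjF
        · exact (Finset.mem_filter.1 hjF).2.ge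
        · exact this
      rw [Finset.sum_add_distrib, Finset.sum_const, smul_eq_mul, Finset.sum_ite_mem,
        Finset.inter_eq_right.2 hFJ, Finset.sum_const, smul_eq_mul, mul_one] at h2
      have h3 : r * (m + J.card - r) ≤ r * (J.card + 2) := Nat.mul_le_mul_left r (by omega)
      nlinarith
  have hFr : F.card ≤ r := by
    have := Finset.card_le_card hFJ
    omega
  have hval : ∀ (Q : Fin n → Prop) [DecidablePred Q],
      (Finset.univ.filter fun a : {j // r < (colSupport Ω j).card} => Q a.1).card ≤
        (Finset.univ.filter Q).card := fun Q _ =>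
    Finset.card_le_card_of_injOn Subtype.val
      (fun a ha => by simpa using ha) Subtype.val_injective.injOn
  obtain ⟨p, hp3, hp2⟩ := exists_distribution_of_full
    (A := {j // r < (colSupport Ω j).card}) (fun j => (colSupport Ω j.1).card = r + 2)
    (fun j => colSupport Ω j.1) r (by
      intro S
      by_cases hS : S.card = r + 1
      · refine (hval fun j => (colSupport Ω j).card = r + 2 ∨ colSupport Ω j = S).trans ?_
        refine (Finset.card_le_card (Finset.monotone_filter_right _ fun j _ hj => ?_)).trans
          (h.card_filter_subset_colSupport_le hS)
        rcases hj with hj | hj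
        · have : colSupport Ω j = Finset.univ := by
            rw [← Finset.card_eq_iff_eq_univ, Fintype.card_fin]
            exact le_antisymm (hle j) (hj ▸ hm)
          rw [this]
          exact Finset.subset_univ S
        · exact hj.ge
      · refine le_trans (Finset.card_le_card_of_injOn Subtype.val (t := F) (fun a ha => ?_)
          Subtype.val_injective.injOn) hFr
        have h1 := a.2
        have h2 := hle a.1
        rcases (Finset.mem_filter.1 ha).2 with ha | ha
        · exact Finset.mem_filter.2 ⟨Finset.mem_univ _, ha⟩
        · refine Finset.mem_filter.2 ⟨Finset.mem_univ _, ?_⟩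
          rw [ha] at h1 h2 ⊢
          omega) (by
      rw [Fintype.card_subtype, Fintype.card_subtype]
      exact (Nat.add_le_add_right (hval _) _).trans hcardle)
  refine isInfinitesimallyIndependent_of_assignment p hp3 fun a b hne hab => ?_
  obtain ⟨ha, hb, hcls⟩ := hp2 a b hne hab
  have h1 := hle a.1
  have h2 := hle b.1
  have h3 := a.2
  have h4 := b.2
  by_contra! hlt
  have h5 := Finset.eq_of_subset_of_card_le
    (Finset.inter_subset_left (s₁ := colSupport Ω a.1) (s₂ := colSupport Ω b.1)) (by omega)
  have h6 := Finset.eq_of_subset_of_card_le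
    (Finset.inter_subset_right (s₁ := colSupport Ω a.1) (s₂ := colSupport Ω b.1)) (by omega)
  exact hcls (h5.symm.trans h6)

/-- In the ranges `r = 1` and `r ≥ min m n - 2`, sparse sets are independent. -/
theorem IsSparse.isIndependent {k : Type*} [Field k] [Infinite k] {m n r : ℕ}
    (hr : r = 1 ∨ min m n ≤ r + 2) {Ω : Finset (Fin m × Fin n)} (h : IsSparse r Ω) :
    IsIndependent k r Ω := by
  apply IsInfinitesimallyIndependent.isIndependent
  rcases hr with rfl | hr
  · exact h.isInfinitesimallyIndependent_one
  rcases min_le_iff.1 hr with hm | hn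
  · exact h.isInfinitesimallyIndependent_of_le hm
  · exact (h.image_swap.isInfinitesimallyIndependent_of_le hn).of_image_swap

/-! ### Heights of elimination ideals -/

/-- An ideal of `B[X_α]` contracting to zero in the Noetherian domain `B` survives in the
polynomial ring over the fraction field of `B`, so its height is at most the number of variables. -/
theorem height_le_card_of_comap_C_eq_bot {B α : Type*} [CommRing B] [IsDomain B] [Finite α]
    (I : Ideal (MvPolynomial α B)) (hI : ∀ b : B, C b ∈ I → b = 0) :
    I.height ≤ (Nat.card α : ℕ∞) := by
  let S : Submonoid (MvPolynomial α B) := (nonZeroDivisors B).map (C (σ := α))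
  have hdisj : Disjoint (I : Set (MvPolynomial α B)) S := by
    rw [Set.disjoint_left]
    rintro _ hbI ⟨b, hb, rfl⟩
    exact nonZeroDivisors.ne_zero hb (hI b hbI)
  obtain ⟨p, hp, hIp, hpS⟩ := Ideal.exists_le_prime_disjoint I S hdisj
  let K := FractionRing B
  let := MvPolynomial.algebraMvPolynomial (σ := α) (R := B) (S := K)
  have h1 := IsLocalization.height_map_of_disjoint (S := MvPolynomial α K) S p hpS.symm
  have := IsLocalization.isPrime_of_isPrime_disjoint S (MvPolynomial α K) p hp hpS.symm
  have h2 := Ideal.height_le_ringKrullDim_of_ne_top (this.ne_top)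
  rw [h1, MvPolynomial.ringKrullDim_of_isNoetherianRing, ringKrullDim_eq_zero_of_field, zero_add] at h2
  refine (Ideal.height_mono hIp).trans ?_
  exact_mod_cast h2

/-- If the contraction of an ideal of `k[X_τ]` to the polynomials in the variables satisfying `P`
is zero, then its height is at most the number of remaining variables. -/
theorem height_le_card_of_rename_mem {k τ : Type*} [Field k] [Finite τ] (P : τ → Prop)
    (I : Ideal (MvPolynomial τ k))
    (hI : ∀ F : MvPolynomial {x // P x} k, rename Subtype.val F ∈ I → F = 0) :
    I.height ≤ (Nat.card {x // ¬ P x} : ℕ∞) := by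
  classical
  let e : MvPolynomial τ k ≃ₐ[k] MvPolynomial {x // ¬ P x} (MvPolynomial {x // P x} k) :=
    (renameEquiv k ((Equiv.sumCompl P).symm.trans (Equiv.sumComm _ _))).trans (sumAlgEquiv k _ _)
  have he : ∀ F : MvPolynomial {x // P x} k, e (rename Subtype.val F) = C F := by
    intro F
    induction F using MvPolynomial.induction_on with
    | C a => simp [e]
    | add p q hp hq => simp only [map_add, hp, hq]
    | mul_X p x hp =>
      rw [map_mul, map_mul, hp, C_mul]
      congr 1
      simp [e, x.2, Equiv.sumCompl_symm_apply_of_pos]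
  rw [← e.toRingEquiv.height_map I]
  refine height_le_card_of_comap_C_eq_bot _ fun F hF => hI F ?_
  rw [← he] at hF
  obtain ⟨G, hG, hGF⟩ := (Ideal.mem_map_of_equiv e.toRingEquiv _).1 hF
  rwa [← e.injective hGF]

theorem rename_mem_detIdeal_of_mem_supportedIdeal {k : Type*} [Field k] {m n r : ℕ}
    {T : Finset (Fin m × Fin n)} {F : MvPolynomial {x // x ∈ T} k}
    (hF : F ∈ supportedIdeal k r T) : rename Subtype.val F ∈ detIdeal k m n (r + 1) := by
  have : supportedIdeal k r T ≤ (detIdeal k m n (r + 1)).comap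
      (rename (Subtype.val : {x // x ∈ T} → Fin m × Fin n)) := by
    rw [supportedIdeal, Ideal.span_le]
    exact fun p hp => Ideal.subset_span hp
  exact this hF

theorem HeightDetects.isDependent {k : Type*} [Field k] {m n r : ℕ}
    {Ω : Finset (Fin m × Fin n)} (h : HeightDetects k r Ω) : IsDependent k r Ω := by
  obtain ⟨T, hT⟩ := h
  intro hind
  refine hT.not_ge ?_
  have hcard : Nat.card {x : {x // x ∈ T} // ¬ x.1 ∈ Ω} = (T \ Ω).card := by
    rw [← Nat.card_eq_finsetCard]
    exact Nat.card_congr ((Equiv.subtypeSubtypeEquivSubtypeInter (· ∈ T) (· ∉ Ω)).trans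
      (Equiv.subtypeEquivRight fun x => by simp))
  rw [← hcard]
  refine height_le_card_of_rename_mem (fun x : {x // x ∈ T} => x.1 ∈ Ω) _ fun F hF => ?_
  have hF' := rename_mem_detIdeal_of_mem_supportedIdeal hF
  have hinj : Function.Injective
      fun x : {x : {x // x ∈ T} // x.1 ∈ Ω} => (⟨x.1.1, x.2⟩ : {x // x ∈ Ω}) :=
    fun x y hxy => Subtype.ext (Subtype.ext (by simpa using hxy))
  refine (map_eq_zero_iff _ (rename_injective _ hinj)).1 (isIndependent_iff.1 hind _ ?_)
  rw [rename_rename] at hF' ⊢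
  exact hF'

/-! ### Products of generic matrices and their deformations -/

/-- The variables `x_{il}`, `y_{lj}` and `w_{ij}` of a generic `m × r` matrix, a generic `r × n`
matrix and a generic `m × n` matrix. -/
abbrev ParamVar (m n r : ℕ) : Type := (Fin m × Fin r) ⊕ (Fin r × Fin n) ⊕ (Fin m × Fin n)

section

variable (k : Type*) [Field k] {m n : ℕ} (r : ℕ)

/-- The generic `m × r` matrix `(x_{il})`. -/
noncomputable def genericLeft (m n : ℕ) : Matrix (Fin m) (Fin r) (MvPolynomial (ParamVar m n r) k) :=
  Matrix.of fun i l => X (Sum.inl (i, l))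

/-- The generic `r × n` matrix `(y_{lj})`. -/
noncomputable def genericRight (m n : ℕ) : Matrix (Fin r) (Fin n) (MvPolynomial (ParamVar m n r) k) :=
  Matrix.of fun l j => X (Sum.inr (Sum.inl (l, j)))

/-- The product of a generic `m × r` matrix and a generic `r × n` matrix, to which independent
variables are added at the positions in `S`. For `S = ∅` this is the generic matrix of rank at
most `r`. -/
noncomputable def deformedProduct (S : Finset (Fin m × Fin n)) :
    Matrix (Fin m) (Fin n) (MvPolynomial (ParamVar m n r) k) :=
  genericLeft k r m n * genericRight k r m n +
    Matrix.of fun i j => if (i, j) ∈ S then X (Sum.inr (Sum.inr (i, j))) else 0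

variable {k r}

/-- Specialization of the variables to given matrices. -/
noncomputable def specialization {A : Type*} [CommRing A] [Algebra k A]
    (X₀ : Matrix (Fin m) (Fin r) A) (Y₀ : Matrix (Fin r) (Fin n) A) (W₀ : Matrix (Fin m) (Fin n) A) :
    MvPolynomial (ParamVar m n r) k →ₐ[k] A :=
  aeval (Sum.elim (fun p => X₀ p.1 p.2) (Sum.elim (fun p => Y₀ p.1 p.2) fun p => W₀ p.1 p.2))

theorem specialization_deformedProduct {A : Type*} [CommRing A] [Algebra k A]
    (X₀ : Matrix (Fin m) (Fin r) A) (Y₀ : Matrix (Fin r) (Fin n) A) (W₀ : Matrix (Fin m) (Fin n) A)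
    (S : Finset (Fin m × Fin n)) (i : Fin m) (j : Fin n) :
    specialization X₀ Y₀ W₀ (deformedProduct k r S i j) =
      (X₀ * Y₀) i j + if (i, j) ∈ S then W₀ i j else 0 := by
  rw [deformedProduct, Matrix.add_apply, map_add, Matrix.mul_apply, Matrix.mul_apply, map_sum]
  congr 1
  · exact Finset.sum_congr rfl fun l _ => by simp [specialization, genericLeft, genericRight]
  · rw [Matrix.of_apply]
    split_ifs <;> simp [specialization]

theorem deformedProduct_empty :
    deformedProduct k r (∅ : Finset (Fin m × Fin n)) = genericLeft k r m n * genericRight k r m n := by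
  ext i j
  simp [deformedProduct]

theorem det_submatrix_deformedProduct_empty (f : Fin (r + 1) → Fin m) (g : Fin (r + 1) → Fin n) :
    ((deformedProduct k r ∅).submatrix f g).det = 0 := by
  rw [deformedProduct_empty]
  exact det_submatrix_mul_eq_zero _ _ f g

theorem aeval_comp_specialization {τ A : Type*} [CommRing A] [Algebra k A] (ι : τ → Fin m × Fin n)
    (S : Finset (Fin m × Fin n)) {F : MvPolynomial τ k}
    (hF : aeval (fun t => deformedProduct k r S (ι t).1 (ι t).2) F = 0)
    (X₀ : Matrix (Fin m) (Fin r) A) (Y₀ : Matrix (Fin r) (Fin n) A)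
    (W₀ : Matrix (Fin m) (Fin n) A) :
    aeval (fun t => (X₀ * Y₀) (ι t).1 (ι t).2 + if ι t ∈ S then W₀ (ι t).1 (ι t).2 else 0) F = 0 := by
  have h := congrArg (specialization X₀ Y₀ W₀) hF
  rw [comp_aeval_apply, map_zero] at h
  simpa only [specialization_deformedProduct] using h

/-- A polynomial vanishing on the generic product vanishes on every matrix over a field whose
`(r + 1)`-minors are zero, since such a matrix is a product. -/
theorem aeval_eq_zero_of_generic {τ L : Type*} [Field L] [Algebra k L] (ι : τ → Fin m × Fin n)
    {F : MvPolynomial τ k}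
    (hF : aeval (fun t => deformedProduct k r ∅ (ι t).1 (ι t).2) F = 0)
    (M : Matrix (Fin m) (Fin n) L)
    (hM : ∀ (f : Fin (r + 1) ↪o Fin m) (g : Fin (r + 1) ↪o Fin n), (M.submatrix f g).det = 0) :
    aeval (fun t => M (ι t).1 (ι t).2) F = 0 := by
  obtain ⟨X₀, Y₀, rfl⟩ := exists_eq_mul_of_minors_eq_zero M hM
  simpa using aeval_comp_specialization ι ∅ hF X₀ Y₀ 0

end

/-! ### The height of the ideal of minors of a block -/

section

variable (k : Type*) [Field k] {m n : ℕ} (r : ℕ) (T : Finset (Fin m × Fin n))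

/-- The ideal of polynomial relations among the entries in `T` of the product of generic matrices
deformed at `S`. -/
noncomputable def relationIdeal (S : Finset (Fin m × Fin n)) :
    Ideal (MvPolynomial {x // x ∈ T} k) :=
  RingHom.ker (aeval (R := k) fun t : {x // x ∈ T} => deformedProduct k r S t.1.1 t.1.2)

instance (S : Finset (Fin m × Fin n)) : (relationIdeal k r T S).IsPrime :=
  RingHom.ker_isPrime _

variable {k r T}

theorem mem_relationIdeal {S : Finset (Fin m × Fin n)} {F : MvPolynomial {x // x ∈ T} k} :
    F ∈ relationIdeal k r T S ↔
      aeval (fun t : {x // x ∈ T} => deformedProduct k r S t.1.1 t.1.2) F = 0 := Iff.rfl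

theorem relationIdeal_antitone {S S' : Finset (Fin m × Fin n)} (h : S ⊆ S') :
    relationIdeal k r T S' ≤ relationIdeal k r T S := by
  intro F hF
  have := aeval_comp_specialization (fun t : {x // x ∈ T} => t.1) S' hF (genericLeft k r m n) (genericRight k r m n)
    (Matrix.of fun i j => if (i, j) ∈ S then X (Sum.inr (Sum.inr (i, j))) else 0)
  rw [mem_relationIdeal, ← this]
  congr 2
  ext1 t
  rw [deformedProduct, Matrix.add_apply, Matrix.of_apply]
  congr 1
  by_cases hS : t.1 ∈ S
  · simp [hS, h hS]
  · simp [hS]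

/-- The minor of the entries in `T` with given rows and columns. -/
noncomputable def supportedMinor (k : Type*) [Field k] {ι : Type*} [Fintype ι] [DecidableEq ι]
    (f : ι → Fin m) (g : ι → Fin n) (h : ∀ a b, (f a, g b) ∈ T) : MvPolynomial {x // x ∈ T} k :=
  (Matrix.of fun a b => X ⟨(f a, g b), h a b⟩).det

theorem aeval_supportedMinor {ι A : Type*} [Fintype ι] [DecidableEq ι] [CommRing A] [Algebra k A]
    (f : ι → Fin m) (g : ι → Fin n) (h : ∀ a b, (f a, g b) ∈ T) (M : {x // x ∈ T} → A) :
    aeval M (supportedMinor k f g h) = (Matrix.of fun a b => M ⟨(f a, g b), h a b⟩).det := by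
  rw [supportedMinor, AlgHom.map_det]
  congr 1
  ext a b
  simp

theorem supportedMinor_mem (f : Fin (r + 1) ↪o Fin m) (g : Fin (r + 1) ↪o Fin n)
    (h : ∀ a b, (f a, g b) ∈ T) : supportedMinor k f g h ∈ supportedIdeal k r T := by
  refine Ideal.subset_span ⟨f, g, ?_⟩
  rw [supportedMinor, AlgHom.map_det]
  congr 1
  ext1 a b
  simp

/-- Dropping the deformation at one position enlarges the relation ideal: the `(r + 1)`-minor
bordering an undeformed `r × r` submatrix by that position becomes a relation. -/
theorem relationIdeal_lt {I : Finset (Fin m)} {J : Finset (Fin n)} {f : Fin r → Fin m}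
    {g : Fin r → Fin n} (hf : Function.Injective f) (hg : Function.Injective g)
    (hfI : ∀ a, f a ∈ I) (hgJ : ∀ a, g a ∈ J)
    {S : Finset (Fin m × Fin n)} (hS : ∀ x ∈ S, (∀ a, x.1 ≠ f a) ∧ (∀ a, x.2 ≠ g a))
    {x : Fin m × Fin n} (hxS : x ∈ S) (hx : x ∈ I ×ˢ J) :
    relationIdeal k r (I ×ˢ J) S < relationIdeal k r (I ×ˢ J) (S.erase x) := by
  rw [Finset.mem_product] at hx
  let f' : Fin (r + 1) → Fin m := Fin.cons x.1 f
  let g' : Fin (r + 1) → Fin n := Fin.cons x.2 g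
  have hT : ∀ a b, (f' a, g' b) ∈ I ×ˢ J := by
    intro a b
    refine Finset.mem_product.2 ⟨?_, ?_⟩
    · cases a using Fin.cases <;> simp [f', hx.1, hfI]
    · cases b using Fin.cases <;> simp [g', hx.2, hgJ]
  have hnot : ∀ a b, ¬ (a = 0 ∧ b = 0) → (f' a, g' b) ∉ S := by
    intro a b hab hmem
    have := hS _ hmem
    cases a using Fin.cases with
    | succ a => exact this.1 a (by simp [f'])
    | zero =>
      cases b using Fin.cases with
      | succ b => exact this.2 b (by simp [g'])
      | zero => exact hab ⟨rfl, rfl⟩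
  refine lt_of_le_not_ge (relationIdeal_antitone (Finset.erase_subset _ _)) fun hle => ?_
  have hmem : supportedMinor k f' g' hT ∈ relationIdeal k r (I ×ˢ J) (S.erase x) := by
    rw [mem_relationIdeal, aeval_supportedMinor]
    rw [← det_submatrix_deformedProduct_empty (k := k) f' g']
    congr 1
    ext1 a b
    have : (f' a, g' b) ∉ S.erase x := by
      by_cases hab : a = 0 ∧ b = 0
      · obtain ⟨rfl, rfl⟩ := hab
        simp [f', g']
      · exact fun h => hnot a b hab (Finset.mem_of_mem_erase h)
    simp only [Matrix.of_apply, Matrix.submatrix_apply, deformedProduct, Matrix.add_apply, if_neg this,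
      Finset.notMem_empty, if_false]
  -- At `X₀ = (0; 1)`, `Y₀ = (0, 1)` and `W₀ = 1` the deformed bordered matrix is the identity.
  have h0 := aeval_comp_specialization (fun t : {y // y ∈ I ×ˢ J} => t.1) S (hle hmem)
    (Matrix.of fun i l => if i = f l then (1 : k) else 0)
    (Matrix.of fun l j => if j = g l then 1 else 0) (Matrix.of fun _ _ => 1)
  rw [aeval_supportedMinor] at h0
  have h1 : (Matrix.of fun a b => ((Matrix.of fun i l => if i = f l then (1 : k) else 0) *
      (Matrix.of fun l j => if j = g l then (1 : k) else 0)) (f' a) (g' b) +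
      if (f' a, g' b) ∈ S then (Matrix.of fun _ _ => (1 : k)) (f' a) (g' b) else 0) = 1 := by
    have hx1 := (hS x hxS).1
    have hx2 := (hS x hxS).2
    ext1 a b
    cases a using Fin.cases with
    | zero =>
      cases b using Fin.cases with
      | zero => simp [f', g', Matrix.mul_apply, hx1, hxS]
      | succ b =>
        rw [Matrix.of_apply, if_neg (hnot _ _ (by simp [Fin.succ_ne_zero]))]
        simp [f', g', Matrix.mul_apply, hx1, (Fin.succ_ne_zero _).symm]
    | succ a =>
      rw [Matrix.of_apply, if_neg (hnot _ _ (by simp [Fin.succ_ne_zero]))]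
      cases b using Fin.cases with
      | zero => simp [f', g', Matrix.mul_apply, hx2]
      | succ b =>
        simp [f', g', Matrix.mul_apply, Matrix.one_apply, hf.eq_iff, hg.eq_iff]
  rw [h1, Matrix.det_one] at h0
  exact one_ne_zero h0

/-- Every prime containing the minors supported on a block contains all relations of the generic
product. -/
theorem relationIdeal_le_of_supportedIdeal_le {I : Finset (Fin m)} {J : Finset (Fin n)}
    (p : Ideal (MvPolynomial {x // x ∈ I ×ˢ J} k)) [p.IsPrime]
    (hp : supportedIdeal k r (I ×ˢ J) ≤ p) : relationIdeal k r (I ×ˢ J) ∅ ≤ p := by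
  intro F hF
  let Q := MvPolynomial {x // x ∈ I ×ˢ J} k ⧸ p
  let L := FractionRing Q
  let π : MvPolynomial {x // x ∈ I ×ˢ J} k →ₐ[k] L :=
    (IsScalarTower.toAlgHom k Q L).comp (Ideal.Quotient.mkₐ k p)
  have hπ : ∀ G, π G = 0 ↔ G ∈ p := fun G => by
    change algebraMap Q L (Ideal.Quotient.mk p G) = 0 ↔ _
    rw [map_eq_zero_iff _ (IsFractionRing.injective Q L), Ideal.Quotient.eq_zero_iff_mem]
  let M : Matrix (Fin m) (Fin n) L :=
    Matrix.of fun i j => if h : (i, j) ∈ I ×ˢ J then π (X ⟨(i, j), h⟩) else 0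
  have hM : ∀ (f : Fin (r + 1) ↪o Fin m) (g : Fin (r + 1) ↪o Fin n),
      (M.submatrix f g).det = 0 := by
    intro f g
    by_cases hfI : ∀ a, f a ∈ I
    swap
    · push Not at hfI
      obtain ⟨a, ha⟩ := hfI
      exact Matrix.det_eq_zero_of_row_eq_zero a fun b => by simp [M, ha]
    by_cases hgJ : ∀ b, g b ∈ J
    swap
    · push Not at hgJ
      obtain ⟨b, hb⟩ := hgJ
      exact Matrix.det_eq_zero_of_column_eq_zero b fun a => by simp [M, hb]
    have hT : ∀ a b, (f a, g b) ∈ I ×ˢ J := fun a b => Finset.mem_product.2 ⟨hfI a, hgJ b⟩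
    have h1 := (hπ _).2 (hp (supportedMinor_mem (k := k) f g hT))
    rw [supportedMinor, AlgHom.map_det] at h1
    rw [← h1]
    congr 1
    ext1 a b
    simp [M, hfI, hgJ]
  have h := aeval_eq_zero_of_generic (fun t : {x // x ∈ I ×ˢ J} => t.1) hF M hM
  rw [← hπ]
  rw [← h]
  conv_lhs => rw [aeval_unique π]
  congr 2
  ext1 t
  simp only [M, Matrix.of_apply, Function.comp_apply, Prod.mk.eta]
  rw [dif_pos t.2]

/-- The lower bound for the height of a determinantal ideal: the relation ideals of deformations
at fewer and fewer positions outside a cross of `r` rows and `r` columns form a chain of primes. -/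
theorem le_height_supportedIdeal (k : Type*) [Field k] {I : Finset (Fin m)} {J : Finset (Fin n)}
    (hI : r < I.card) (hJ : r < J.card) :
    (((I.card - r) * (J.card - r) : ℕ) : ℕ∞) ≤ (supportedIdeal k r (I ×ˢ J)).height := by
  obtain ⟨I₀, hI₀, hI₀c⟩ := Finset.exists_subset_card_eq hI.le
  obtain ⟨J₀, hJ₀, hJ₀c⟩ := Finset.exists_subset_card_eq hJ.le
  let f := I₀.orderEmbOfFin hI₀c
  let g := J₀.orderEmbOfFin hJ₀c
  set D := (I \ I₀) ×ˢ (J \ J₀) with hD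
  have hDf : ∀ x ∈ D, (∀ a, x.1 ≠ f a) ∧ (∀ a, x.2 ≠ g a) := by
    intro x hx
    rw [hD, Finset.mem_product, Finset.mem_sdiff, Finset.mem_sdiff] at hx
    exact ⟨fun a ha => hx.1.2 (ha ▸ Finset.orderEmbOfFin_mem _ _ _),
      fun a ha => hx.2.2 (ha ▸ Finset.orderEmbOfFin_mem _ _ _)⟩
  have hDT : D ⊆ I ×ˢ J := Finset.product_subset_product Finset.sdiff_subset Finset.sdiff_subset
  have hchain : ∀ U ⊆ D, (U.card : ℕ∞) ≤ (relationIdeal k r (I ×ˢ J) (D \ U)).height := by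
    intro U
    induction U using Finset.induction_on with
    | empty => simp
    | insert x U hxU ih =>
      intro hUD
      rw [Finset.insert_subset_iff] at hUD
      have hxD : x ∈ D \ U := Finset.mem_sdiff.2 ⟨hUD.1, hxU⟩
      have hlt := relationIdeal_lt (k := k) f.injective g.injective
        (fun a => hI₀ (Finset.orderEmbOfFin_mem _ hI₀c a))
        (fun a => hJ₀ (Finset.orderEmbOfFin_mem _ hJ₀c a))
        (fun y hy => hDf y (Finset.mem_sdiff.1 hy).1) hxD (hDT hUD.1)
      rw [Finset.card_insert_of_notMem hxU, Finset.sdiff_insert]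
      push_cast
      exact (add_le_add_left (ih hUD.2) 1).trans (Ideal.height_add_one_le_of_lt_of_isPrime hlt)
  have hDc : D.card = (I.card - r) * (J.card - r) := by
    rw [hD, Finset.card_product, Finset.card_sdiff_of_subset hI₀, Finset.card_sdiff_of_subset hJ₀,
      hI₀c, hJ₀c]
  have h := hchain D subset_rfl
  rw [hDc, Finset.sdiff_self] at h
  rw [Ideal.height_eq_inf_minimalPrimes (supportedIdeal k r (I ×ˢ J))]
  refine le_iInf₂ fun p hp => h.trans (Ideal.height_mono ?_)
  have := hp.isPrime
  exact relationIdeal_le_of_supportedIdeal_le p hp.le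

end

/-! ### The algebraic matroid of the generic product -/

section

variable (k : Type*) [Field k] (m n r : ℕ)

/-- The fraction field of the polynomial ring in the entries of the generic factors. -/
abbrev ParamField : Type _ := FractionRing (MvPolynomial (ParamVar m n r) k)

/-- The generic matrix of rank at most `r`, over the field generated by its factors. -/
noncomputable def genericMatrix : Matrix (Fin m) (Fin n) (ParamField k m n r) :=
  (deformedProduct k r ∅).map (algebraMap _ _)

/-- The algebraic matroid of the entries of the generic matrix of rank at most `r`. -/
noncomputable def entryMatroid : Matroid (Fin m × Fin n) :=
  (AlgebraicIndependent.matroid k (ParamField k m n r)).comap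
    fun x => genericMatrix k m n r x.1 x.2

variable {k m n r}

theorem aeval_genericMatrix_eq_zero_iff {τ : Type*} (ι : τ → Fin m × Fin n)
    (F : MvPolynomial τ k) : aeval (fun t => genericMatrix k m n r (ι t).1 (ι t).2) F = 0 ↔
      aeval (fun t => deformedProduct k r ∅ (ι t).1 (ι t).2) F = 0 := by
  rw [← map_eq_zero_iff _ (IsFractionRing.injective (MvPolynomial (ParamVar m n r) k)
    (ParamField k m n r)), ← IsScalarTower.toAlgHom_apply k, comp_aeval_apply]
  rfl

/-- Since a polynomial vanishing on the generic product lies in every prime containing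
`I_{r+1}(Z)`, independence with respect to `I_{r+1}(Z)` is independence of the entries of the
generic product; that `I_{r+1}(Z)` is prime is not needed. -/
theorem IsIndependent.indep {Ω : Finset (Fin m × Fin n)} (h : IsIndependent k r Ω) :
    (entryMatroid k m n r).Indep Ω := by
  have halg : AlgebraicIndepOn k (fun x => genericMatrix k m n r x.1 x.2)
      (Ω : Set (Fin m × Fin n)) := by
    change AlgebraicIndependent k
      fun x : {x // x ∈ Ω} => genericMatrix k m n r x.1.1 x.1.2
    rw [algebraicIndependent_iff]
    intro F hF
    rw [aeval_genericMatrix_eq_zero_iff (fun x : {x // x ∈ Ω} => x.1)] at hF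
    have hrad : rename Subtype.val F ∈ (detIdeal k m n (r + 1)).radical := by
      rw [Ideal.radical_eq_sInf, Ideal.mem_sInf]
      rintro p ⟨hp, hprime⟩
      let L := FractionRing (MvPolynomial (Fin m × Fin n) k ⧸ p)
      let π : MvPolynomial (Fin m × Fin n) k →ₐ[k] L :=
        (IsScalarTower.toAlgHom k _ L).comp (Ideal.Quotient.mkₐ k p)
      have hπ : ∀ G, π G = 0 ↔ G ∈ p := fun G => by
        change algebraMap _ L (Ideal.Quotient.mk p G) = 0 ↔ _
        rw [map_eq_zero_iff _ (IsFractionRing.injective _ L), Ideal.Quotient.eq_zero_iff_mem]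
      have h0 := aeval_eq_zero_of_generic (fun x : {x // x ∈ Ω} => x.1) hF
        (Matrix.of fun i j => π (X (i, j))) fun f g => by
          have := (hπ _).2 (hp (Ideal.subset_span ⟨f, g, rfl⟩))
          rw [AlgHom.map_det] at this
          rw [← this]
          congr 1
      rw [← hπ, ← h0]
      conv_lhs => rw [aeval_unique π, aeval_rename]
      rfl
    obtain ⟨N, hN⟩ := hrad
    rw [← map_pow] at hN
    exact IsReduced.eq_zero F ⟨N, isIndependent_iff.1 h _ hN⟩
  have hinj : Set.InjOn (fun x => genericMatrix k m n r x.1 x.2) (Ω : Set (Fin m × Fin n)) :=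
    fun x hx y hy hxy => congrArg Subtype.val (halg.injective (a₁ := ⟨x, hx⟩) (a₂ := ⟨y, hy⟩) hxy)
  exact Matroid.comap_indep_iff.2 ⟨(algebraicIndependent_image hinj).1 halg, hinj⟩

/-- A set of entries contained in `r` rows, or in `r` columns, is independent: setting all other
entries to zero kills the `(r + 1)`-minors. -/
theorem isIndependent_of_subset_product {Ω : Finset (Fin m × Fin n)} {I : Finset (Fin m)}
    {J : Finset (Fin n)} (hIJ : min I.card J.card ≤ r) (hΩ : Ω ⊆ I ×ˢ J) :
    IsIndependent k r Ω := by
  rw [isIndependent_iff]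
  intro F hF
  have h := aeval_eq_zero_of_mem_detIdeal
    (Matrix.of fun i j => if h : (i, j) ∈ Ω then
      (X ⟨(i, j), h⟩ : MvPolynomial {x // x ∈ Ω} k) else 0) (fun f g => ?_) hF
  · rw [aeval_rename] at h
    rw [← h]
    conv_lhs => rw [← aeval_X_left_apply (R := k) F]
    congr 2
    ext1 x
    simp
  · have hmem : ∀ a b, (f a, g b) ∈ Ω → f a ∈ I ∧ g b ∈ J := fun a b hab =>
      Finset.mem_product.1 (hΩ hab)
    rcases min_le_iff.1 hIJ with hI | hJ
    · obtain ⟨a, ha⟩ : ∃ a, f a ∉ I := by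
        by_contra! hall
        have := Finset.card_le_card_of_injOn (s := Finset.univ) f (fun a _ => hall a)
          f.injective.injOn
        simp only [Finset.card_univ, Fintype.card_fin] at this
        omega
      exact Matrix.det_eq_zero_of_row_eq_zero a fun b => by
        have : (f a, g b) ∉ Ω := fun h => ha (hmem a b h).1
        simp [this]
    · obtain ⟨b, hb⟩ : ∃ b, g b ∉ J := by
        by_contra! hall
        have := Finset.card_le_card_of_injOn (s := Finset.univ) g (fun b _ => hall b)
          g.injective.injOn
        simp only [Finset.card_univ, Fintype.card_fin] at this
        omega
      exact Matrix.det_eq_zero_of_column_eq_zero b fun a => by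
        have : (f a, g b) ∉ Ω := fun h => hb (hmem a b h).2
        simp [this]

theorem det_mem_subalgebra {R A ι : Type*} [CommRing R] [CommRing A] [Algebra R A] [Fintype ι]
    [DecidableEq ι] (S : Subalgebra R A) {M : Matrix ι ι A} (h : ∀ i j, M i j ∈ S) : M.det ∈ S := by
  rw [Matrix.det_apply]
  refine S.sum_mem fun σ _ => ?_
  rw [Units.smul_def]
  exact zsmul_mem (S.prod_mem fun i _ => h _ _) _

theorem adjugate_mem_subalgebra {R A ι : Type*} [CommRing R] [CommRing A] [Algebra R A] [Fintype ι]
    [DecidableEq ι] (S : Subalgebra R A) {M : Matrix ι ι A} (h : ∀ i j, M i j ∈ S) (i j : ι) :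
    M.adjugate i j ∈ S := by
  rw [Matrix.adjugate_apply]
  refine det_mem_subalgebra S fun a b => ?_
  rw [Matrix.updateRow_apply, Pi.single_apply]
  split_ifs
  exacts [S.one_mem, S.zero_mem, h a b]

/-- The entries of a matrix factoring through `R ^ r` are determined by a cross of `r` rows and
`r` columns, up to the determinant of the submatrix in which they meet. -/
theorem det_mul_entry_eq {R α β : Type*} [CommRing R] (U : Matrix α (Fin r) R)
    (V : Matrix (Fin r) β R) (f : Fin r → α) (g : Fin r → β) (i : α) (j : β) :
    ((U * V).submatrix f g).det * (U * V) i j =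
      ∑ a, ∑ b, (U * V) i (g a) * (((U * V).submatrix f g).adjugate a b * (U * V) (f b) j) := by
  have h1 : (U * V).submatrix f g = U.submatrix f id * V.submatrix id g :=
    Matrix.submatrix_mul U V f id g Function.bijective_id
  have h2 : (U * V).submatrix id g * (((U * V).submatrix f g).adjugate * (U * V).submatrix f id) =
      ((U * V).submatrix f g).det • (U * V) := by
    have h3 : (U * V).submatrix id g = U * V.submatrix id g :=
      Matrix.submatrix_mul U V id id g Function.bijective_id
    have h4 : (U * V).submatrix f id = U.submatrix f id * V :=
      Matrix.submatrix_mul U V f id id Function.bijective_id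
    rw [h3, h4, h1, Matrix.adjugate_mul_distrib, Matrix.det_mul]
    calc U * V.submatrix id g * ((V.submatrix id g).adjugate * (U.submatrix f id).adjugate *
          (U.submatrix f id * V))
        = U * (V.submatrix id g * (V.submatrix id g).adjugate) *
          ((U.submatrix f id).adjugate * U.submatrix f id) * V := by simp only [Matrix.mul_assoc]
      _ = _ := by
        rw [Matrix.mul_adjugate, Matrix.adjugate_mul]
        simp [smul_smul]
  clear h1
  generalize U * V = W at h2 ⊢
  have h5 := congrFun (congrFun h2 i) j
  rw [Matrix.smul_apply, smul_eq_mul] at h5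
  rw [← h5, Matrix.mul_apply]
  refine Finset.sum_congr rfl fun a _ => ?_
  rw [Matrix.mul_apply, Finset.mul_sum]
  rfl

theorem exists_genericMatrix_eq_mul :
    ∃ (U : Matrix (Fin m) (Fin r) (ParamField k m n r))
      (V : Matrix (Fin r) (Fin n) (ParamField k m n r)), genericMatrix k m n r = U * V :=
  ⟨_, _, by rw [genericMatrix, deformedProduct_empty, Matrix.map_mul]⟩

theorem det_genericMatrix_submatrix_ne_zero {f : Fin r → Fin m} {g : Fin r → Fin n}
    (hf : Function.Injective f) (hg : Function.Injective g) :
    ((genericMatrix k m n r).submatrix f g).det ≠ 0 := by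
  have h1 : (genericMatrix k m n r).submatrix f g =
      (algebraMap _ (ParamField k m n r)).mapMatrix ((deformedProduct k r ∅).submatrix f g) := rfl
  rw [h1, ← RingHom.map_det, Ne, map_eq_zero_iff _ (IsFractionRing.injective _ _)]
  intro h0
  have h2 := congrArg (specialization (Matrix.of fun i l => if i = f l then (1 : k) else 0)
    (Matrix.of fun l j => if j = g l then (1 : k) else 0) 0) h0
  rw [AlgHom.map_det, map_zero] at h2
  refine one_ne_zero (α := k) ?_
  rw [← h2, ← Matrix.det_one (n := Fin r)]
  congr 1
  ext1 a b
  rw [AlgHom.mapMatrix_apply, Matrix.map_apply, Matrix.submatrix_apply,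
    specialization_deformedProduct]
  simp [Matrix.mul_apply, Matrix.one_apply, hf.eq_iff, hg.eq_iff]

/-- The entries of a block are algebraic over those in a cross of `r` of its rows and `r` of its
columns, which bounds the rank of the block. -/
theorem eRk_product_le {I : Finset (Fin m)} {J : Finset (Fin n)} (hI : r ≤ I.card)
    (hJ : r ≤ J.card) : (entryMatroid k m n r).eRk (I ×ˢ J : Finset (Fin m × Fin n)) +
      (((I.card - r) * (J.card - r) : ℕ) : ℕ∞) ≤ ((I ×ˢ J).card : ℕ∞) := by
  obtain ⟨I₀, hI₀, hI₀c⟩ := Finset.exists_subset_card_eq hI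
  obtain ⟨J₀, hJ₀, hJ₀c⟩ := Finset.exists_subset_card_eq hJ
  let f := I₀.orderEmbOfFin hI₀c
  let g := J₀.orderEmbOfFin hJ₀c
  have hf : ∀ a, f a ∈ I₀ := Finset.orderEmbOfFin_mem _ hI₀c
  have hg : ∀ a, g a ∈ J₀ := Finset.orderEmbOfFin_mem _ hJ₀c
  set D := (I \ I₀) ×ˢ (J \ J₀) with hD
  have hDc : D.card = (I.card - r) * (J.card - r) := by
    rw [hD, Finset.card_product, Finset.card_sdiff_of_subset hI₀, Finset.card_sdiff_of_subset hJ₀,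
      hI₀c, hJ₀c]
  have hDT : D ⊆ I ×ˢ J := Finset.product_subset_product Finset.sdiff_subset Finset.sdiff_subset
  set cross := (I ×ˢ J) \ D with hcross
  let G := genericMatrix k m n r
  let v : Fin m × Fin n → ParamField k m n r := fun x => G x.1 x.2
  let Alg := Subalgebra.algebraicClosure
    (Algebra.adjoin k (v '' (cross : Set (Fin m × Fin n)))) (ParamField k m n r)
  have hmem : ∀ x ∈ cross, v x ∈ Alg := fun x hx =>
    isAlgebraic_algebraMap (⟨v x, Algebra.subset_adjoin ⟨x, hx, rfl⟩⟩ :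
      Algebra.adjoin k (v '' (cross : Set (Fin m × Fin n))))
  have hrow : ∀ a, ∀ j ∈ J, G (f a) j ∈ Alg := fun a j hj => hmem (f a, j) (by
    simp [hcross, hD, hf, hj, hI₀ (hf a)])
  have hcol : ∀ b, ∀ i ∈ I, G i (g b) ∈ Alg := fun b i hi => hmem (i, g b) (by
    simp [hcross, hD, hg, hi, hJ₀ (hg b)])
  have hsub : ∀ a b, G.submatrix f g a b ∈ Alg := fun a b => hrow a _ (hJ₀ (hg b))
  have hdet : (G.submatrix f g).det ∈ Alg := det_mem_subalgebra Alg hsub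
  have hadj : ∀ a b, (G.submatrix f g).adjugate a b ∈ Alg := adjugate_mem_subalgebra Alg hsub
  have hblock : ∀ x ∈ I ×ˢ J, v x ∈ Alg := by
    rintro ⟨i, j⟩ hx
    obtain ⟨hi, hj⟩ := Finset.mem_product.1 hx
    obtain ⟨U, V, hUV⟩ := exists_genericMatrix_eq_mul (k := k) (m := m) (n := n) (r := r)
    have h1 := det_mul_entry_eq U V f g i j
    rw [← hUV] at h1
    have h2 : v (i, j) = (G.submatrix f g).det⁻¹ * ((G.submatrix f g).det * G i j) := by
      rw [inv_mul_cancel_left₀ (det_genericMatrix_submatrix_ne_zero f.injective g.injective)]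
    rw [h2, h1]
    refine Alg.mul_mem (IsAlgebraic.inv hdet) (Subalgebra.sum_mem _ fun a _ =>
      Subalgebra.sum_mem _ fun b _ => Alg.mul_mem (hcol a i hi) (Alg.mul_mem (hadj a b) (hrow b j hj)))
  have hle : (entryMatroid k m n r).eRk (I ×ˢ J : Finset (Fin m × Fin n)) ≤ cross.card := by
    rw [entryMatroid, Matroid.eRk_comap]
    have hsub : v '' (I ×ˢ J : Finset (Fin m × Fin n)) ⊆
        (AlgebraicIndependent.matroid k (ParamField k m n r)).closure (v '' cross) := by
      rw [AlgebraicIndependent.matroid_closure_eq]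
      rintro _ ⟨x, hx, rfl⟩
      exact hblock x hx
    refine ((Matroid.eRk_mono _ hsub).trans (Matroid.eRk_closure_eq _ _).le).trans ?_
    refine (Matroid.eRk_le_encard _ _).trans ((Set.encard_image_le _ _).trans ?_)
    rw [Set.encard_coe_eq_coe_finsetCard]
  have hcc : cross.card + (I.card - r) * (J.card - r) = (I ×ˢ J).card := by
    rw [← hDc, hcross, Finset.card_sdiff_add_card_eq_card hDT]
  rw [← hcc, Nat.cast_add]
  exact add_le_add_left hle _

/-- Submodularity adds up the nullities of blocks, each of which meets the union of its
predecessors in an independent set. -/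
theorem rank_biUnion_add_sum_le {s : ℕ} (I : Fin s → Finset (Fin m)) (J : Fin s → Finset (Fin n))
    (hcard : ∀ α, r < (I α).card ∧ r < (J α).card)
    (hinter : ∀ α : Fin s, 0 < α.val → ∃ (I' : Finset (Fin m)) (J' : Finset (Fin n)),
      min I'.card J'.card ≤ r ∧
      (I α ×ˢ J α) ∩ ((Finset.univ.filter fun β => β < α).biUnion fun β => I β ×ˢ J β)
        ⊆ I' ×ˢ J') (t : ℕ) (ht : t ≤ s) :
    (entryMatroid k m n r).eRk
        ((Finset.univ.filter fun β : Fin s => β.val < t).biUnion fun β => I β ×ˢ J β :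
          Finset (Fin m × Fin n)) +
      ((∑ β ∈ Finset.univ.filter fun β : Fin s => β.val < t,
        ((I β).card - r) * ((J β).card - r) : ℕ) : ℕ∞) ≤
      (((Finset.univ.filter fun β : Fin s => β.val < t).biUnion fun β => I β ×ˢ J β).card : ℕ∞) := by
  induction t with
  | zero => simp
  | succ t ih =>
    let α : Fin s := ⟨t, ht⟩
    have hfil : (Finset.univ.filter fun β : Fin s => β.val < t + 1) =
        insert α (Finset.univ.filter fun β : Fin s => β.val < t) := by
      ext β
      simp only [Finset.mem_filter, Finset.mem_univ, true_and, Finset.mem_insert, Fin.ext_iff, α]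
      omega
    have hα : α ∉ Finset.univ.filter fun β : Fin s => β.val < t := by simp [α]
    have hlt : (Finset.univ.filter fun β => β < α) = Finset.univ.filter fun β : Fin s => β.val < t :=
      rfl
    set P := Finset.univ.filter fun β : Fin s => β.val < t with hP
    set U := P.biUnion fun β => I β ×ˢ J β with hU
    have hind : (entryMatroid k m n r).Indep ((I α ×ˢ J α) ∩ U : Finset (Fin m × Fin n)) := by
      rcases Nat.eq_zero_or_pos t with h0 | hpos
      · have : U = ∅ := by simp [hU, hP, h0]
        simp [this]
      · obtain ⟨I', J', hmin, hsub⟩ := hinter α hpos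
        rw [hlt] at hsub
        exact (isIndependent_of_subset_product hmin hsub).indep
    have h1 := (entryMatroid k m n r).eRk_inter_add_eRk_union_le
      (I α ×ˢ J α : Finset (Fin m × Fin n)) U
    have h2 := eRk_product_le (k := k) (hcard α).1.le (hcard α).2.le
    have h3 := ih (by omega)
    have h4 := Finset.card_union_add_card_inter (I α ×ˢ J α) U
    rw [← Finset.coe_inter, hind.eRk_eq_encard, Set.encard_coe_eq_coe_finsetCard,
      ← Finset.coe_union] at h1
    rw [hfil, Finset.biUnion_insert, Finset.sum_insert hα, ← hU]
    have hfin : ∀ S : Finset (Fin m × Fin n), ∃ c : ℕ, (entryMatroid k m n r).eRk S = c := fun S =>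
      ⟨_, (ENat.natCast_toNat (ne_top_of_le_ne_top (by
        rw [Set.encard_coe_eq_coe_finsetCard]; exact ENat.natCast_ne_top _)
        ((entryMatroid k m n r).eRk_le_encard S))).symm⟩
    obtain ⟨c1, hc1⟩ := hfin (I α ×ˢ J α)
    obtain ⟨c2, hc2⟩ := hfin U
    obtain ⟨c3, hc3⟩ := hfin (I α ×ˢ J α ∪ U)
    rw [hc1, hc2, hc3] at h1
    rw [hc1] at h2
    rw [hc2] at h3
    rw [hc3]
    norm_cast at h1 h2 h3 ⊢
    omega

theorem BlocksDetect.isDependent {Ω : Finset (Fin m × Fin n)} (h : BlocksDetect r Ω) :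
    IsDependent k r Ω := by
  obtain ⟨s, I, J, hcard, hinter, hlt⟩ := h
  intro hind
  have h1 := rank_biUnion_add_sum_le (k := k) I J hcard hinter s le_rfl
  have hfil : (Finset.univ.filter fun β : Fin s => β.val < s) = Finset.univ := by
    ext β
    simp
  rw [hfil] at h1
  set U := Finset.univ.biUnion fun α => I α ×ˢ J α
  have h2 := (hind.subset (Finset.inter_subset_right (s₁ := U))).indep.encard_le_eRk_of_subset
    (Finset.coe_subset.2 (Finset.inter_subset_left (s₂ := Ω)))
  rw [Set.encard_coe_eq_coe_finsetCard] at h2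
  have h3 := (add_le_add_left h2 _).trans h1
  norm_cast at h3
  have := Finset.card_sdiff_add_card_inter U Ω
  omega

end

/-! ### The three criteria -/

theorem exists_block_of_isDependent {k : Type*} [Field k] [Infinite k]
    {m n r : ℕ} (hr : r = 1 ∨ min m n ≤ r + 2) {Ω : Finset (Fin m × Fin n)}
    (h : IsDependent k r Ω) :
    ∃ (I : Finset (Fin m)) (J : Finset (Fin n)), r < I.card ∧ r < J.card ∧
      r * (I.card + J.card - r) < (Ω ∩ (I ×ˢ J)).card := by
  by_contra! hno
  exact h (IsSparse.isIndependent hr hno)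

/-- A block too dense in `Ω` has fewer entries outside `Ω` than its codimension. -/
theorem card_product_sdiff_lt {m n r : ℕ} {Ω : Finset (Fin m × Fin n)} {I : Finset (Fin m)}
    {J : Finset (Fin n)} (hI : r < I.card) (hJ : r < J.card)
    (h : r * (I.card + J.card - r) < (Ω ∩ (I ×ˢ J)).card) :
    ((I ×ˢ J) \ Ω).card < (I.card - r) * (J.card - r) := by
  have h1 := Finset.card_sdiff_add_card_inter (I ×ˢ J) Ω
  rw [Finset.inter_comm, Finset.card_product] at h1
  obtain ⟨a, ha⟩ := Nat.exists_eq_add_of_lt hI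
  obtain ⟨b, hb⟩ := Nat.exists_eq_add_of_lt hJ
  rw [ha, hb] at h1 h ⊢
  rw [show r + a + 1 + (r + b + 1) - r = r + a + b + 2 by omega] at h
  rw [show r + a + 1 - r = a + 1 by omega, show r + b + 1 - r = b + 1 by omega]
  nlinarith

end DeterminantalMatroid

theorem mainTheorem3 (k : Type*) [Field k] [Infinite k] (m n r : ℕ)
    (hr : r = 1 ∨ min m n ≤ r + 2) (Ω : Finset (Fin m × Fin n)) :
    (DeterminantalMatroid.IsDependent k r Ω →
      ∃ (I : Finset (Fin m)) (J : Finset (Fin n)), r < I.card ∧ r < J.card ∧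
        r * (I.card + J.card - r) < (Ω ∩ (I ×ˢ J)).card) ∧
    (DeterminantalMatroid.IsDependent k r Ω ↔ DeterminantalMatroid.HeightDetects k r Ω) ∧
    (DeterminantalMatroid.IsDependent k r Ω ↔ DeterminantalMatroid.BlocksDetect r Ω) := by
  refine ⟨fun h => DeterminantalMatroid.exists_block_of_isDependent hr h,
    ⟨fun h => ?_, fun h => h.isDependent⟩, ⟨fun h => ?_, fun h => h.isDependent⟩⟩
  · obtain ⟨I, J, hI, hJ, hlt⟩ := DeterminantalMatroid.exists_block_of_isDependent hr h
    refine ⟨I ×ˢ J, lt_of_lt_of_le ?_ (DeterminantalMatroid.le_height_supportedIdeal k hI hJ)⟩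
    exact_mod_cast DeterminantalMatroid.card_product_sdiff_lt hI hJ hlt
  · obtain ⟨I, J, hI, hJ, hlt⟩ := DeterminantalMatroid.exists_block_of_isDependent hr h
    refine ⟨1, fun _ => I, fun _ => J, fun _ => ⟨hI, hJ⟩, fun α hα => ?_, ?_⟩
    · exact absurd hα (by simp [Subsingleton.elim α 0])
    · simpa using DeterminantalMatroid.card_product_sdiff_lt hI hJ hlt
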